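/- Let $k$ be a field and let $A$ be a bialgebra over $k$ with multiplication $\mu$ and comultiplication $\Delta$; write $\otimes=\otimes_k$, $\mathrm{Hom}=\mathrm{Hom}_k$ and $\Delta(a)=\sum a_1\otimes a_2$. A left-right Hopf module over $A$ is a $k$-vector space $M$ with a left $A$-module structure $\omega_M:A\otimes M\to M$, $a\otimes m\mapsto a\cdot m$, and a right $A$-comodule structure $\rho_M:M\to M\otimes A$, $m\mapsto\sum m_0\otimes m_1$, such that $\rho_M(a\cdot m)=\sum a_1\cdot m_0\otimes a_2m_1$ for all $a\in A$, $m\in M$; morphisms are the $A$-linear $A$-colinear maps. Let $M,N$ be left-right Hopf modules over $A$. For $n,p\ge 0$ put $C^{n,p}(M,N)=\mathrm{Hom}(A^{\otimes n}\otimes M,\,N\otimes A^{\otimes p})$. Let $d_m=\sum_{i=0}^{n+1}(-1)^ib_i:C^{n,p}\to C^{n+1,p}$ and $d_c=\sum_{i=0}^{p+1}(-1)^ic_i:C^{n,p}\to C^{n,p+1}$, where: * $b_0(f)(a^1\otimes\cdots\otimes a^{n+1}\otimes m)=a^1\cdot f(a^2\otimes\cdots\otimes a^{n+1}\otimes m)$,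 with the diagonal action $a\cdot(x\otimes y^1\otimes\cdots\otimes y^p)=\sum a_1\cdot x\otimes a_2y^1\otimes\cdots\otimes a_{p+1}y^p$ of $A$ on $N\otimes A^{\otimes p}$; for $1\le i\le n$, $b_i(f)(a^1\otimes\cdots\otimes a^{n+1}\otimes m)=f(a^1\otimes\cdots\otimes a^ia^{i+1}\otimes\cdots\otimes a^{n+1}\otimes m)$; and $b_{n+1}(f)(a^1\otimes\cdots\otimes a^{n+1}\otimes m)=f(a^1\otimes\cdots\otimes a^n\otimes a^{n+1}\cdot m)$; * $c_0(f)=(\rho_N\otimes\mathrm{id})\circ f$; for $1\le i\le p$, $c_i(f)$ is $f$ followed by $\Delta$ applied to the $i$-th factor $A$ of $N\otimes A^{\otimes p}$; and $c_{p+1}(f)(a^1\otimes\cdots\otimes a^n\otimes m)=\sum f((a^1)_1\otimes\cdots\otimes(a^n)_1\otimes m_0)\otimes(a^1)_2\cdots(a^n)_2m_1$. Let $H^q(M,N)$ be the cohomology in degree $q$ of the total complex $\bigoplus_{n+p=q}C^{n,p}(M,N)$ with differential $d_m+(-1)^nd_c$ on $C^{n,p}$. Let $Z^1(M,N)$ be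 the space of all pairs $(\omega',\rho')\in\mathrm{Hom}(A\otimes M,N)\oplus\mathrm{Hom}(M,N\otimes A)$ with $$\omega'\circ(\mathrm{id}\otimes\omega_M)+\omega_N\circ(\mathrm{id}\otimes\omega')=\omega'\circ(\mu\otimes\mathrm{id}),$$ $$(\rho'\otimes\mathrm{id})\circ\rho_M+(\rho_N\otimes\mathrm{id})\circ\rho'=(\mathrm{id}\otimes\Delta)\circ\rho',$$ $$(\omega'\otimes\mu)\circ(\mathrm{id}\otimes\tau_M\otimes\mathrm{id})\circ(\Delta\otimes\rho_M)+(\omega_N\otimes\mu)\circ(\mathrm{id}\otimes\tau_N\otimes\mathrm{id})\circ(\Delta\otimes\rho')=\rho'\circ\omega_M+\rho_N\circ\omega',$$ where $\tau_X:A\otimes X\to X\otimes A$ is the flip, and let $B^1(M,N)$ be the space of all pairs $(\omega_N\circ(\mathrm{id}\otimes f)-f\circ\omega_M,\ \rho_N\circ f-(f\otimes\mathrm{id})\circ\rho_M)$ with $f\in\mathrm{Hom}(M,N)$. Let $\mathrm{Ext}^1(M,N)$ be the set of equivalence classes of extensions $0\to N\to E\to M\to 0$ of $M$ by $N$ in the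 category of left-right Hopf modules over $A$, with the Baer sum as its group law. Then: 1. $B^1(M,N)\subseteq Z^1(M,N)$, and $H^1(M,N)= Z^1(M,N)/B^1(M,N)$: there is a $k$-linear isomorphism sending the class of a $1$-cocycle of the total complex to the class of the pair $(\omega',\rho')$ of its components in $C^{1,0}(M,N)$ and $C^{0,1}(M,N)$. 2. The groups $H^1(M,N)$ and $\mathrm{Ext}^1(M,N)$ are isomorphic. -/

import Mathlib

open scoped TensorProduct

universe v u

namespace HopfCoh

noncomputable section

/-- A shortcut instance: the usual additive group of linear maps into `Y ⊗ A`. -/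
instance instAddCommGroupHomTensor {k X Y A : Type*} [Field k] [AddCommGroup X] [Module k X]
    [AddCommGroup Y] [Module k Y] [Ring A] [Algebra k A] :
    AddCommGroup (X →ₗ[k] Y ⊗[k] A) := LinearMap.addCommGroup

/-! ## Left-right Hopf modules -/

/-- A right comodule over a coalgebra: a coassociative and counital map `M → M ⊗ C`. -/
class RightComodule (k : Type*) (C : Type*) (M : Type*) [Field k] [AddCommGroup C] [Module k C]
    [Coalgebra k C] [AddCommGroup M] [Module k M] where
  /-- The coaction `ρ : M → M ⊗ C`. -/
  coact : M →ₗ[k] M ⊗[k] C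
  /-- `(ρ ⊗ id) ∘ ρ = (id ⊗ Δ) ∘ ρ` -/
  coact_coassoc : (TensorProduct.assoc k M C C).toLinearMap ∘ₗ coact.rTensor C ∘ₗ coact =
    (Coalgebra.comul (R := k) (A := C)).lTensor M ∘ₗ coact
  /-- `(id ⊗ ε) ∘ ρ = id` -/
  coact_counit : (TensorProduct.rid k M).toLinearMap ∘ₗ
    (Coalgebra.counit (R := k) (A := C)).lTensor M ∘ₗ coact = LinearMap.id

/-- The coaction `ρ_M : M → M ⊗ A`. -/
abbrev rho (k : Type*) (A : Type*) (M : Type*) [Field k] [Ring A] [Bialgebra k A]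
    [AddCommGroup M] [Module k M] [RightComodule k A M] : M →ₗ[k] M ⊗[k] A :=
  RightComodule.coact

/-- The action `ω_M : A ⊗ M → M`, `a ⊗ m ↦ a • m`. -/
def omega (k : Type*) (A : Type*) (M : Type*) [Field k] [Ring A] [Algebra k A]
    [AddCommGroup M] [Module k M] [Module A M] [IsScalarTower k A M] : A ⊗[k] M →ₗ[k] M :=
  TensorProduct.lift (Algebra.lsmul k k M : A →ₐ[k] Module.End k M).toLinearMap

/-- For a linear map `α : A ⊗ X → Y` and `γ : L → X ⊗ A`, the map `A ⊗ L → Y ⊗ A` given by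
`a ⊗ l ↦ ∑ α (a₁ ⊗ l₀) ⊗ a₂ l₁`, where `γ l = ∑ l₀ ⊗ l₁`; that is,
`(α ⊗ μ) ∘ (id ⊗ τ ⊗ id) ∘ (Δ ⊗ γ)`. -/
def twist {k A X Y L : Type*} [Field k] [Ring A] [Bialgebra k A]
    [AddCommGroup X] [Module k X] [AddCommGroup Y] [Module k Y] [AddCommGroup L] [Module k L]
    (α : A ⊗[k] X →ₗ[k] Y) (γ : L →ₗ[k] X ⊗[k] A) : A ⊗[k] L →ₗ[k] Y ⊗[k] A :=
  TensorProduct.map α (LinearMap.mul' k A) ∘ₗ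
    (TensorProduct.tensorTensorTensorComm k A A X A).toLinearMap ∘ₗ
    TensorProduct.map (Coalgebra.comul (R := k) (A := A)) γ

/-- For `α : A ⊗ Y → Z`, the linear map sending `f : X → Y` to `α ∘ (id ⊗ f) : A ⊗ X → Z`. -/
def actComp {k A X Y Z : Type*} [Field k] [AddCommGroup A] [Module k A]
    [AddCommGroup X] [Module k X] [AddCommGroup Y] [Module k Y] [AddCommGroup Z] [Module k Z]
    (α : A ⊗[k] Y →ₗ[k] Z) : (X →ₗ[k] Y) →ₗ[k] (A ⊗[k] X →ₗ[k] Z) where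
  toFun f := α ∘ₗ f.lTensor A
  map_add' f g := by rw [LinearMap.lTensor_add, LinearMap.comp_add]
  map_smul' r f := by rw [LinearMap.lTensor_smul, LinearMap.comp_smul, RingHom.id_apply]

/-- For `γ : L → X ⊗ A`, the linear map sending `f : X → Y` to `(f ⊗ id) ∘ γ : L → Y ⊗ A`. -/
def coactComp {k A L X Y : Type*} [Field k] [AddCommGroup A] [Module k A]
    [AddCommGroup L] [Module k L] [AddCommGroup X] [Module k X] [AddCommGroup Y] [Module k Y]
    (γ : L →ₗ[k] X ⊗[k] A) : (X →ₗ[k] Y) →ₗ[k] (L →ₗ[k] Y ⊗[k] A) where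
  toFun f := f.rTensor A ∘ₗ γ
  map_add' f g := by rw [LinearMap.rTensor_add, LinearMap.add_comp]
  map_smul' r f := by rw [LinearMap.rTensor_smul, LinearMap.smul_comp, RingHom.id_apply]

/-- A left-right Hopf module over a bialgebra `A`: a left `A`-module and right `A`-comodule with
`∑ (a • m)₀ ⊗ (a • m)₁ = ∑ a₁ • m₀ ⊗ a₂ m₁`. -/
class HopfModule (k : Type*) (A : Type*) (M : Type*) [Field k] [Ring A] [Bialgebra k A]
    [AddCommGroup M] [Module k M] [Module A M] [IsScalarTower k A M]
    extends RightComodule k A M where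
  /-- The Hopf module compatibility condition. -/
  compat : coact ∘ₗ omega k A M = twist (omega k A M) coact

/-- Morphisms of left-right Hopf modules are the `A`-linear maps that are also `A`-colinear. -/
def IsColinear (k : Type*) {A M N : Type*} [Field k] [Ring A] [Bialgebra k A]
    [AddCommGroup M] [Module k M] [Module A M] [IsScalarTower k A M] [HopfModule k A M]
    [AddCommGroup N] [Module k N] [Module A N] [IsScalarTower k A N] [HopfModule k A N]
    (f : M →ₗ[A] N) : Prop :=
  rho k A N ∘ₗ f.restrictScalars k = (f.restrictScalars k).rTensor A ∘ₗ rho k A M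

/-! ## The double complex -/

/-- `A^n ⊗ M`, bracketed as `A ⊗ (A ⊗ (⋯ ⊗ M))`. -/
def LT (k : Type v) (A M : Type u) [Field k] [Ring A] [Bialgebra k A]
    [AddCommGroup M] [Module k M] : ℕ → ModuleCat.{u} k
  | 0 => ModuleCat.of k M
  | n + 1 => ModuleCat.of k (A ⊗[k] LT k A M n)

/-- `N ⊗ A^p`, bracketed as `((N ⊗ A) ⊗ ⋯) ⊗ A`. -/
def RT (k : Type v) (A N : Type u) [Field k] [Ring A] [Bialgebra k A]
    [AddCommGroup N] [Module k N] : ℕ → ModuleCat.{u} k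
  | 0 => ModuleCat.of k N
  | p + 1 => ModuleCat.of k (RT k A N p ⊗[k] A)

section complex

variable (k : Type v) (A M N : Type u) [Field k] [Ring A] [Bialgebra k A]
  [AddCommGroup M] [Module k M] [Module A M] [IsScalarTower k A M] [HopfModule k A M]
  [AddCommGroup N] [Module k N] [Module A N] [IsScalarTower k A N] [HopfModule k A N]

/-- The diagonal action of `A` on `N ⊗ A^p`:
`a · (x ⊗ b¹ ⊗ ⋯ ⊗ b^p) = ∑ a₁ • x ⊗ a₂ b¹ ⊗ ⋯ ⊗ a_{p+1} b^p`. -/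
def diagAct : (p : ℕ) → (A ⊗[k] RT k A N p →ₗ[k] RT k A N p)
  | 0 => omega k A N
  | p + 1 => twist (diagAct p) (LinearMap.id : RT k A N p ⊗[k] A →ₗ[k] RT k A N p ⊗[k] A)

/-- The codiagonal coaction of `A` on `A^n ⊗ M`:
`a¹ ⊗ ⋯ ⊗ aⁿ ⊗ m ↦ ∑ (a¹)₁ ⊗ ⋯ ⊗ (aⁿ)₁ ⊗ m₀ ⊗ (a¹)₂ ⋯ (aⁿ)₂ m₁`. -/
def diagCoact : (n : ℕ) → (LT k A M n →ₗ[k] LT k A M n ⊗[k] A)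
  | 0 => rho k A M
  | n + 1 => twist (LinearMap.id : A ⊗[k] LT k A M n →ₗ[k] A ⊗[k] LT k A M n) (diagCoact n)

/-- For `0 ≤ i ≤ n`, the map `A^{n+1} ⊗ M → A^n ⊗ M` multiplying the factors in the positions
`i` and `i + 1`, counted from `0`; for `i = n` it is `id ⊗ ω_M`. (It is used for `i ≤ n` only.) -/
def face : (n : ℕ) → (i : ℕ) → (LT k A M (n + 1) →ₗ[k] LT k A M n)
  | 0, _ => omega k A M
  | n + 1, 0 => (LinearMap.mul' k A).rTensor (LT k A M n) ∘ₗ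
      (TensorProduct.assoc k A A (LT k A M n)).symm.toLinearMap
  | n + 1, i + 1 => (face n i).lTensor A

/-- For `0 ≤ i ≤ p`, the map `N ⊗ A^p → N ⊗ A^{p+1}` applying the coaction of `N` for `i = 0`, and
the comultiplication to the `i`-th factor `A` for `1 ≤ i ≤ p`. (It is used for `i ≤ p` only.) -/
def coface : (p : ℕ) → (i : ℕ) → (RT k A N p →ₗ[k] RT k A N (p + 1))
  | 0, _ => rho k A N
  | p + 1, i => if i = p + 1 then
        (TensorProduct.assoc k (RT k A N p) A A).symm.toLinearMap ∘ₗ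
          (Coalgebra.comul (R := k) (A := A)).lTensor (RT k A N p)
      else (coface p i).rTensor A

/-- `C^{n,p}(M, N) = Hom (A^n ⊗ M, N ⊗ A^p)`. -/
abbrev C (n p : ℕ) := LT k A M n →ₗ[k] RT k A N p

/-- `b_i : C^{n,p} → C^{n+1,p}` for `0 ≤ i ≤ n + 1`. -/
def b (n p : ℕ) : ℕ → (C k A M N n p →ₗ[k] C k A M N (n + 1) p)
  | 0 => actComp (diagAct k A N p)
  | i + 1 =>
    { toFun := fun f => f ∘ₗ face k A M n i
      map_add' := fun _ _ => LinearMap.add_comp _ _ _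
      map_smul' := fun _ _ => LinearMap.smul_comp _ _ _ }

/-- `c_i : C^{n,p} → C^{n,p+1}` for `0 ≤ i ≤ p + 1`. -/
def c (n p : ℕ) (i : ℕ) : C k A M N n p →ₗ[k] C k A M N n (p + 1) :=
  if i = p + 1 then coactComp (diagCoact k A M n)
  else
    { toFun := fun f => coface k A N p i ∘ₗ f
      map_add' := fun _ _ => LinearMap.comp_add _ _ _
      map_smul' := fun _ _ => LinearMap.comp_smul _ _ _ }

/-- `d_m = ∑_{i=0}^{n+1} (-1)^i b_i`. -/
def dm (n p : ℕ) : C k A M N n p →ₗ[k] C k A M N (n + 1) p :=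
  ∑ i ∈ Finset.range (n + 2), (-1 : k) ^ i • b k A M N n p i

/-- `d_c = ∑_{i=0}^{p+1} (-1)^i c_i`. -/
def dc (n p : ℕ) : C k A M N n p →ₗ[k] C k A M N n (p + 1) :=
  ∑ i ∈ Finset.range (p + 2), (-1 : k) ^ i • c k A M N n p i

/-! ## The total complex and its cohomology -/

/-- The total complex in degree `q`: the (finite) direct sum of the `C^{n,p}` with `n + p = q`. -/
abbrev Tot (q : ℕ) := (x : {x : ℕ × ℕ // x.1 + x.2 = q}) → C k A M N x.1.1 x.1.2

/-- The component of the total differential at `(n, p)` that comes from `d_m`. -/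
def totM (q : ℕ) : (n p : ℕ) → n + p = q + 1 → (Tot k A M N q →ₗ[k] C k A M N n p)
  | 0, _, _ => 0
  | n + 1, p, h => dm k A M N n p ∘ₗ
      LinearMap.proj (R := k) (φ := fun x : {x : ℕ × ℕ // x.1 + x.2 = q} => C k A M N x.1.1 x.1.2)
        ⟨(n, p), by omega⟩

/-- The component of the total differential at `(n, p)` that comes from `(-1)^n d_c`. -/
def totC (q : ℕ) : (n p : ℕ) → n + p = q + 1 → (Tot k A M N q →ₗ[k] C k A M N n p)
  | _, 0, _ => 0
  | n, p + 1, h => (-1 : k) ^ n • (dc k A M N n p ∘ₗ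
      LinearMap.proj (R := k) (φ := fun x : {x : ℕ × ℕ // x.1 + x.2 = q} => C k A M N x.1.1 x.1.2)
        ⟨(n, p), by omega⟩)

/-- The total differential `D = d_m + (-1)^n d_c`. -/
def totD (q : ℕ) : Tot k A M N q →ₗ[k] Tot k A M N (q + 1) :=
  LinearMap.pi fun x =>
    totM k A M N q x.1.1 x.1.2 x.2 +
    totC k A M N q x.1.1 x.1.2 x.2

/-- The coboundaries of the total complex in degree `q`. -/
def totB : (q : ℕ) → Submodule k (Tot k A M N q)
  | 0 => ⊥
  | q + 1 => LinearMap.range (totD k A M N q)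

/-- `H^q(M, N)`: the cohomology of the total complex in degree `q`. -/
abbrev H (q : ℕ) :=
  LinearMap.ker (totD k A M N q) ⧸ (totB k A M N q).submoduleOf (LinearMap.ker (totD k A M N q))

/-! ## Explicit cocycles and coboundaries -/

/-- `Z¹(M, N)`: the pairs `(ω', ρ')` with
`ω' ∘ (id ⊗ ω_M) + ω_N ∘ (id ⊗ ω') = ω' ∘ (μ ⊗ id)`,
`(ρ' ⊗ id) ∘ ρ_M + (ρ_N ⊗ id) ∘ ρ' = (id ⊗ Δ) ∘ ρ'` and
`(ω' ⊗ μ)(id ⊗ τ ⊗ id)(Δ ⊗ ρ_M) + (ω_N ⊗ μ)(id ⊗ τ ⊗ id)(Δ ⊗ ρ') = ρ' ∘ ω_M + ρ_N ∘ ω'`. -/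
def Z1 : Submodule k ((A ⊗[k] M →ₗ[k] N) × (M →ₗ[k] N ⊗[k] A)) where
  carrier := {z |
    z.1 ∘ₗ (omega k A M).lTensor A + omega k A N ∘ₗ z.1.lTensor A =
      z.1 ∘ₗ (LinearMap.mul' k A).rTensor M ∘ₗ (TensorProduct.assoc k A A M).symm.toLinearMap ∧
    (TensorProduct.assoc k N A A).toLinearMap ∘ₗ
        (z.2.rTensor A ∘ₗ rho k A M + (rho k A N).rTensor A ∘ₗ z.2) =
      (Coalgebra.comul (R := k) (A := A)).lTensor N ∘ₗ z.2 ∧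
    twist z.1 (rho k A M) + twist (omega k A N) z.2 =
      z.2 ∘ₗ omega k A M + rho k A N ∘ₗ z.1}
  zero_mem' := by
    simp [twist]
  add_mem' := by
    rintro x y ⟨h1, h2, h3⟩ ⟨g1, g2, g3⟩
    refine ⟨?_, ?_, ?_⟩
    · simp only [Prod.fst_add, LinearMap.add_comp, LinearMap.comp_add, LinearMap.lTensor_add,
        ← h1, ← g1]
      abel
    · simp only [Prod.snd_add, LinearMap.add_comp, LinearMap.comp_add, LinearMap.rTensor_add,
        ← h2, ← g2]
      abel
    · have e : ∀ s t s' t' : A ⊗[k] M →ₗ[k] N ⊗[k] A, (s + s') + (t + t') = (s + t) + (s' + t') :=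
        fun s t s' t' => by abel
      simp only [twist, Prod.fst_add, Prod.snd_add, LinearMap.add_comp, LinearMap.comp_add,
        TensorProduct.map_add_left, TensorProduct.map_add_right] at h3 g3 ⊢
      rw [e, h3, g3]
      abel
  smul_mem' := by
    rintro r x ⟨h1, h2, h3⟩
    refine ⟨?_, ?_, ?_⟩
    · simp only [Prod.smul_fst, LinearMap.smul_comp, LinearMap.comp_smul, LinearMap.lTensor_smul,
        ← h1, smul_add]
    · simp only [Prod.smul_snd, LinearMap.smul_comp, LinearMap.comp_smul, LinearMap.rTensor_smul,
        ← h2, ← smul_add]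
    · simp only [twist, Prod.smul_fst, Prod.smul_snd, LinearMap.smul_comp, LinearMap.comp_smul,
        TensorProduct.map_smul_left, TensorProduct.map_smul_right, ← smul_add] at h3 ⊢
      rw [h3]

/-- `B¹(M, N)`: the pairs `(ω_N ∘ (id ⊗ f) - f ∘ ω_M, ρ_N ∘ f - (f ⊗ id) ∘ ρ_M)`,
for linear maps `f : M → N`. -/
def B1 : Submodule k ((A ⊗[k] M →ₗ[k] N) × (M →ₗ[k] N ⊗[k] A)) where
  carrier := {z | ∃ f : M →ₗ[k] N,
    z = (omega k A N ∘ₗ f.lTensor A - f ∘ₗ omega k A M,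
      rho k A N ∘ₗ f - f.rTensor A ∘ₗ rho k A M)}
  zero_mem' := ⟨0, by simp only [LinearMap.lTensor_zero, LinearMap.rTensor_zero,
    LinearMap.zero_comp, LinearMap.comp_zero, sub_zero]; rfl⟩
  add_mem' := by
    rintro _ _ ⟨f, rfl⟩ ⟨g, rfl⟩
    refine ⟨f + g, ?_⟩
    ext1 <;> simp only [Prod.mk_add_mk, LinearMap.add_comp, LinearMap.comp_add,
      LinearMap.rTensor_add, LinearMap.lTensor_add] <;> abel
  smul_mem' := by
    rintro r _ ⟨f, rfl⟩
    refine ⟨r • f, ?_⟩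
    ext1 <;> simp only [Prod.smul_mk, LinearMap.smul_comp, LinearMap.comp_smul,
      LinearMap.rTensor_smul, LinearMap.lTensor_smul, smul_sub]

end complex

/-! ## Sub- and quotient Hopf modules -/

section naturality

variable {k A X Y Z L L' : Type*} [Field k] [Ring A] [Bialgebra k A]
  [AddCommGroup X] [Module k X] [AddCommGroup Y] [Module k Y] [AddCommGroup Z] [Module k Z]
  [AddCommGroup L] [Module k L] [AddCommGroup L'] [Module k L']

theorem rTensor_comp_twist (g : Y →ₗ[k] Z) (α : A ⊗[k] X →ₗ[k] Y) (γ : L →ₗ[k] X ⊗[k] A) :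
    g.rTensor A ∘ₗ twist α γ = twist (g ∘ₗ α) γ := by
  simp only [twist, LinearMap.rTensor, ← LinearMap.comp_assoc, ← TensorProduct.map_comp,
    LinearMap.id_comp]

theorem twist_lTensor (g : X →ₗ[k] Y) (α : A ⊗[k] Y →ₗ[k] Z) (γ : L →ₗ[k] X ⊗[k] A) :
    twist (α ∘ₗ g.lTensor A) γ = twist α (g.rTensor A ∘ₗ γ) := by
  refine TensorProduct.ext' fun a l => ?_
  simp only [twist, LinearMap.comp_apply, TensorProduct.map_tmul, LinearEquiv.coe_coe]
  generalize Coalgebra.comul (R := k) a = s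
  generalize γ l = t
  induction s with
  | zero => simp
  | add s s' hs hs' => simp only [TensorProduct.add_tmul, map_add, hs, hs']
  | tmul a b =>
    induction t with
    | zero => simp
    | add t t' ht ht' => simp only [TensorProduct.tmul_add, map_add, ht, ht']
    | tmul x d => simp

theorem twist_comp (h : L' →ₗ[k] L) (α : A ⊗[k] X →ₗ[k] Y) (γ : L →ₗ[k] X ⊗[k] A) :
    twist α (γ ∘ₗ h) = twist α γ ∘ₗ h.lTensor A := by
  refine TensorProduct.ext' fun a l => ?_
  simp [twist]

theorem assoc_rTensor_nat (g : Y →ₗ[k] X) (κ : Y →ₗ[k] Y ⊗[k] A) (ρ : X →ₗ[k] X ⊗[k] A)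
    (h : g.rTensor A ∘ₗ κ = ρ ∘ₗ g) :
    g.rTensor (A ⊗[k] A) ∘ₗ ((TensorProduct.assoc k Y A A).toLinearMap ∘ₗ κ.rTensor A ∘ₗ κ) =
      ((TensorProduct.assoc k X A A).toLinearMap ∘ₗ ρ.rTensor A ∘ₗ ρ) ∘ₗ g := by
  have e : g.rTensor (A ⊗[k] A) ∘ₗ (TensorProduct.assoc k Y A A).toLinearMap =
      (TensorProduct.assoc k X A A).toLinearMap ∘ₗ (g.rTensor A).rTensor A :=
    TensorProduct.ext_threefold fun y a b => by simp
  rw [← LinearMap.comp_assoc, e, LinearMap.comp_assoc, LinearMap.comp_assoc, LinearMap.comp_assoc,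
    ← LinearMap.comp_assoc κ, ← LinearMap.rTensor_comp, h, LinearMap.rTensor_comp,
    LinearMap.comp_assoc, h]

theorem lTensor_comul_nat (g : Y →ₗ[k] X) (κ : Y →ₗ[k] Y ⊗[k] A) (ρ : X →ₗ[k] X ⊗[k] A)
    (h : g.rTensor A ∘ₗ κ = ρ ∘ₗ g) :
    g.rTensor (A ⊗[k] A) ∘ₗ ((Coalgebra.comul (R := k) (A := A)).lTensor Y ∘ₗ κ) =
      ((Coalgebra.comul (R := k) (A := A)).lTensor X ∘ₗ ρ) ∘ₗ g := by
  rw [← LinearMap.comp_assoc, LinearMap.rTensor_comp_lTensor, ← LinearMap.lTensor_comp_rTensor,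
    LinearMap.comp_assoc, h, LinearMap.comp_assoc]

theorem counit_nat (g : Y →ₗ[k] X) (κ : Y →ₗ[k] Y ⊗[k] A) (ρ : X →ₗ[k] X ⊗[k] A)
    (h : g.rTensor A ∘ₗ κ = ρ ∘ₗ g) :
    g ∘ₗ ((TensorProduct.rid k Y).toLinearMap ∘ₗ
        (Coalgebra.counit (R := k) (A := A)).lTensor Y ∘ₗ κ) =
      ((TensorProduct.rid k X).toLinearMap ∘ₗ
        (Coalgebra.counit (R := k) (A := A)).lTensor X ∘ₗ ρ) ∘ₗ g := by
  have e : g ∘ₗ (TensorProduct.rid k Y).toLinearMap =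
      (TensorProduct.rid k X).toLinearMap ∘ₗ g.rTensor k :=
    TensorProduct.ext' fun y a => by simp
  rw [← LinearMap.comp_assoc, e, LinearMap.comp_assoc, LinearMap.comp_assoc, LinearMap.comp_assoc,
    ← h, ← LinearMap.comp_assoc κ, LinearMap.rTensor_comp_lTensor,
    ← LinearMap.lTensor_comp_rTensor, LinearMap.comp_assoc]

variable [Module A X] [IsScalarTower k A X] [Module A Y] [IsScalarTower k A Y]

@[simp]
theorem omega_tmul (a : A) (x : X) : omega k A X (a ⊗ₜ x) = a • x := by
  simp [omega]

theorem omega_nat (g : Y →ₗ[A] X) :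
    g.restrictScalars k ∘ₗ omega k A Y = omega k A X ∘ₗ (g.restrictScalars k).lTensor A :=
  TensorProduct.ext' fun a y => by simp

theorem twist_omega_nat (g : Y →ₗ[A] X) (κ : Y →ₗ[k] Y ⊗[k] A) (ρ : X →ₗ[k] X ⊗[k] A)
    (h : (g.restrictScalars k).rTensor A ∘ₗ κ = ρ ∘ₗ g.restrictScalars k) :
    (g.restrictScalars k).rTensor A ∘ₗ twist (omega k A Y) κ =
      twist (omega k A X) ρ ∘ₗ (g.restrictScalars k).lTensor A := by
  rw [rTensor_comp_twist, omega_nat, twist_lTensor, h, twist_comp]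

/-- The Hopf module structure on the source of an injective `A`-linear map into a Hopf module,
for a map `κ` that is the restriction of the coaction. -/
abbrev HopfModule.ofInjective [HopfModule k A X] (g : Y →ₗ[A] X) (hg : Function.Injective g)
    (κ : Y →ₗ[k] Y ⊗[k] A)
    (h : (g.restrictScalars k).rTensor A ∘ₗ κ = rho k A X ∘ₗ g.restrictScalars k) :
    HopfModule k A Y where
  coact := κ
  coact_coassoc := by
    have hi := Module.Flat.rTensor_preserves_injective_linearMap (M := A ⊗[k] A)
      (g.restrictScalars k) hg
    rw [← LinearMap.cancel_left hi, assoc_rTensor_nat _ _ _ h, lTensor_comul_nat _ _ _ h,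
      RightComodule.coact_coassoc]
  coact_counit := by
    rw [← LinearMap.cancel_left (f := g.restrictScalars k) hg, counit_nat _ _ _ h,
      RightComodule.coact_counit]
    rfl
  compat := by
    have hi := Module.Flat.rTensor_preserves_injective_linearMap (M := A)
      (g.restrictScalars k) hg
    rw [← LinearMap.cancel_left hi, twist_omega_nat _ _ _ h, ← HopfModule.compat,
      ← LinearMap.comp_assoc, h, LinearMap.comp_assoc, LinearMap.comp_assoc, omega_nat]

/-- The Hopf module structure on the target of a surjective `A`-linear map from a Hopf module,
for a map `κ` that is induced by the coaction. -/
abbrev HopfModule.ofSurjective [HopfModule k A Y] (g : Y →ₗ[A] X) (hg : Function.Surjective g)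
    (κ : X →ₗ[k] X ⊗[k] A)
    (h : (g.restrictScalars k).rTensor A ∘ₗ rho k A Y = κ ∘ₗ g.restrictScalars k) :
    HopfModule k A X where
  coact := κ
  coact_coassoc := by
    refine (LinearMap.cancel_right (g := g.restrictScalars k) hg).1 ?_
    rw [← assoc_rTensor_nat _ _ _ h,
      ← lTensor_comul_nat _ _ _ h, RightComodule.coact_coassoc]
  coact_counit := by
    refine (LinearMap.cancel_right (g := g.restrictScalars k) hg).1 ?_
    rw [← counit_nat _ _ _ h,
      RightComodule.coact_counit]
    rfl
  compat := by
    have hs : Function.Surjective ((g.restrictScalars k).lTensor A) :=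
      LinearMap.lTensor_surjective A hg
    rw [← LinearMap.cancel_right hs, ← twist_omega_nat _ _ _ h, ← HopfModule.compat,
      ← LinearMap.comp_assoc, h, LinearMap.comp_assoc, LinearMap.comp_assoc, omega_nat]

end naturality

section constructions

variable {k A X Y : Type*} [Field k] [Ring A] [Bialgebra k A]
  [AddCommGroup X] [Module k X] [Module A X] [IsScalarTower k A X] [HopfModule k A X]
  [AddCommGroup Y] [Module k Y] [Module A Y] [IsScalarTower k A Y] [HopfModule k A Y]

/-- The coaction of the direct sum of two Hopf modules. -/
def prodCoact (k A X Y : Type*) [Field k] [Ring A] [Bialgebra k A]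
    [AddCommGroup X] [Module k X] [RightComodule k A X]
    [AddCommGroup Y] [Module k Y] [RightComodule k A Y] : X × Y →ₗ[k] (X × Y) ⊗[k] A :=
  LinearMap.coprod ((LinearMap.inl k X Y).rTensor A ∘ₗ rho k A X)
    ((LinearMap.inr k X Y).rTensor A ∘ₗ rho k A Y)

/-- The direct sum of two Hopf modules. -/
instance instHopfModuleProd : HopfModule k A (X × Y) where
  coact := prodCoact k A X Y
  coact_coassoc := by
    have hl : (LinearMap.inl k X Y).rTensor A ∘ₗ rho k A X =
        prodCoact k A X Y ∘ₗ LinearMap.inl k X Y := by simp [prodCoact]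
    have hr : (LinearMap.inr k X Y).rTensor A ∘ₗ rho k A Y =
        prodCoact k A X Y ∘ₗ LinearMap.inr k X Y := by simp [prodCoact]
    refine LinearMap.prod_ext ?_ ?_
    · rw [← assoc_rTensor_nat _ _ _ hl, ← lTensor_comul_nat _ _ _ hl,
        RightComodule.coact_coassoc]
    · rw [← assoc_rTensor_nat _ _ _ hr, ← lTensor_comul_nat _ _ _ hr,
        RightComodule.coact_coassoc]
  coact_counit := by
    have hl : (LinearMap.inl k X Y).rTensor A ∘ₗ rho k A X =
        prodCoact k A X Y ∘ₗ LinearMap.inl k X Y := by simp [prodCoact]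
    have hr : (LinearMap.inr k X Y).rTensor A ∘ₗ rho k A Y =
        prodCoact k A X Y ∘ₗ LinearMap.inr k X Y := by simp [prodCoact]
    refine LinearMap.prod_ext ?_ ?_
    · rw [← counit_nat _ _ _ hl, RightComodule.coact_counit]; rfl
    · rw [← counit_nat _ _ _ hr, RightComodule.coact_counit]; rfl
  compat := by
    have hl : ((LinearMap.inl A X Y).restrictScalars k).rTensor A ∘ₗ rho k A X =
        prodCoact k A X Y ∘ₗ (LinearMap.inl A X Y).restrictScalars k :=
      (LinearMap.coprod_inl _ _).symm
    have hr : ((LinearMap.inr A X Y).restrictScalars k).rTensor A ∘ₗ rho k A Y =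
        prodCoact k A X Y ∘ₗ (LinearMap.inr A X Y).restrictScalars k :=
      (LinearMap.coprod_inr _ _).symm
    have el : (prodCoact k A X Y ∘ₗ omega k A (X × Y)) ∘ₗ
          ((LinearMap.inl A X Y).restrictScalars k).lTensor A =
        twist (omega k A (X × Y)) (prodCoact k A X Y) ∘ₗ
          ((LinearMap.inl A X Y).restrictScalars k).lTensor A := by
      rw [← twist_omega_nat _ _ _ hl, ← HopfModule.compat, ← LinearMap.comp_assoc, hl,
        LinearMap.comp_assoc, LinearMap.comp_assoc, omega_nat]
    have er : (prodCoact k A X Y ∘ₗ omega k A (X × Y)) ∘ₗ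
          ((LinearMap.inr A X Y).restrictScalars k).lTensor A =
        twist (omega k A (X × Y)) (prodCoact k A X Y) ∘ₗ
          ((LinearMap.inr A X Y).restrictScalars k).lTensor A := by
      rw [← twist_omega_nat _ _ _ hr, ← HopfModule.compat, ← LinearMap.comp_assoc, hr,
        LinearMap.comp_assoc, LinearMap.comp_assoc, omega_nat]
    refine TensorProduct.ext' fun a z => ?_
    have hz : z = LinearMap.inl A X Y z.1 + LinearMap.inr A X Y z.2 := by simp
    have e1 := LinearMap.congr_fun el (a ⊗ₜ z.1)
    have e2 := LinearMap.congr_fun er (a ⊗ₜ z.2)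
    rw [hz, TensorProduct.tmul_add, map_add, map_add]
    exact congrArg₂ (· + ·) e1 e2

theorem rho_prod (z : X × Y) : rho k A (X × Y) z =
    (LinearMap.inl k X Y).rTensor A (rho k A X z.1) +
      (LinearMap.inr k X Y).rTensor A (rho k A Y z.2) := rfl

/-- The inclusion of the kernel of an `A`-linear map, as a `k`-linear map. -/
abbrev kerIncl (k : Type*) {A X Y : Type*} [Field k] [Ring A] [Algebra k A]
    [AddCommGroup X] [Module k X] [Module A X] [IsScalarTower k A X]
    [AddCommGroup Y] [Module A Y] (f : X →ₗ[A] Y) : LinearMap.ker f →ₗ[k] X :=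
  (LinearMap.ker f).subtype.restrictScalars k

theorem kerIncl_rTensor_injective {k A X Y : Type*} [Field k] [Ring A] [Algebra k A]
    [AddCommGroup X] [Module k X] [Module A X] [IsScalarTower k A X]
    [AddCommGroup Y] [Module A Y] (f : X →ₗ[A] Y) :
    Function.Injective ((kerIncl k f).rTensor A) :=
  Module.Flat.rTensor_preserves_injective_linearMap _ Subtype.val_injective

theorem rho_mem_range (f : X →ₗ[A] Y) (hf : IsColinear k f) (x : LinearMap.ker f) :
    rho k A X x ∈ LinearMap.range ((kerIncl k f).rTensor A) := by
  have hex : Function.Exact (kerIncl k f) (f.restrictScalars k) := fun y => by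
    simp [kerIncl]
  have := Module.Flat.rTensor_exact A hex
  refine (this _).1 ?_
  have h := LinearMap.congr_fun hf x.1
  simp only [LinearMap.comp_apply, LinearMap.coe_restrictScalars] at h
  rw [← h, LinearMap.mem_ker.1 x.2, map_zero]

/-- The coaction on the kernel of a morphism of Hopf modules: the restriction of the coaction. -/
def kerCoact (f : X →ₗ[A] Y) (hf : IsColinear k f) :
    LinearMap.ker f →ₗ[k] LinearMap.ker f ⊗[k] A :=
  (LinearEquiv.ofInjective _ (kerIncl_rTensor_injective f)).symm.toLinearMap ∘ₗ
    (rho k A X ∘ₗ kerIncl k f).codRestrict (LinearMap.range ((kerIncl k f).rTensor A))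
      (rho_mem_range f hf)

theorem kerCoact_spec (f : X →ₗ[A] Y) (hf : IsColinear k f) :
    (kerIncl k f).rTensor A ∘ₗ kerCoact f hf = rho k A X ∘ₗ kerIncl k f := by
  ext x
  exact congrArg Subtype.val ((LinearEquiv.ofInjective _
    (kerIncl_rTensor_injective (k := k) f)).apply_symm_apply
      (⟨rho k A X x, rho_mem_range f hf x⟩ : LinearMap.range ((kerIncl k f).rTensor A)))

/-- The kernel of a morphism of Hopf modules. -/
abbrev kerHopf (f : X →ₗ[A] Y) (hf : IsColinear k f) : HopfModule k A (LinearMap.ker f) :=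
  HopfModule.ofInjective (LinearMap.ker f).subtype Subtype.val_injective (kerCoact f hf)
    (kerCoact_spec f hf)

/-- The coaction on the cokernel of a morphism of Hopf modules: induced by the coaction. -/
def cokerCoact (f : X →ₗ[A] Y) (hf : IsColinear k f) :
    (Y ⧸ LinearMap.range f) →ₗ[k] (Y ⧸ LinearMap.range f) ⊗[k] A where
  toFun := Quotient.lift
    (fun y => ((LinearMap.range f).mkQ.restrictScalars k).rTensor A (rho k A Y y)) (by
      intro y y' hy
      have hy : y - y' ∈ LinearMap.range f := (Submodule.quotientRel_def _).1 hy
      obtain ⟨x, hx⟩ := hy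
      rw [← sub_eq_zero, ← map_sub, ← map_sub, ← hx]
      have h := LinearMap.congr_fun hf x
      simp only [LinearMap.comp_apply, LinearMap.coe_restrictScalars] at h
      have h0 : (LinearMap.range f).mkQ.restrictScalars k ∘ₗ f.restrictScalars k = 0 := by
        ext x
        simp
      rw [h, ← LinearMap.rTensor_comp_apply, h0, LinearMap.rTensor_zero, LinearMap.zero_apply])
  map_add' := by
    rintro ⟨y⟩ ⟨y'⟩
    exact map_add (((LinearMap.range f).mkQ.restrictScalars k).rTensor A ∘ₗ rho k A Y) y y'
  map_smul' := by
    rintro r ⟨y⟩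
    exact map_smul (((LinearMap.range f).mkQ.restrictScalars k).rTensor A ∘ₗ rho k A Y) r y

/-- The cokernel of a morphism of Hopf modules. -/
abbrev cokerHopf (f : X →ₗ[A] Y) (hf : IsColinear k f) : HopfModule k A (Y ⧸ LinearMap.range f) :=
  HopfModule.ofSurjective (LinearMap.range f).mkQ (Submodule.mkQ_surjective _) (cokerCoact f hf)
    rfl

end constructions

/-! ## Extensions of Hopf modules and the Baer sum -/

section ext

variable (k : Type v) (A M N : Type u) [Field k] [Ring A] [Bialgebra k A]
  [AddCommGroup M] [Module k M] [Module A M] [IsScalarTower k A M] [HopfModule k A M]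
  [AddCommGroup N] [Module k N] [Module A N] [IsScalarTower k A N] [HopfModule k A N]

/-- An extension of `M` by `N` in the category of left-right Hopf modules: a short exact sequence
`0 → N → E → M → 0` of Hopf modules. -/
structure Extension where
  /-- The middle term. -/
  E : Type u
  [addCommGroup : AddCommGroup E]
  [moduleField : Module k E]
  [moduleRing : Module A E]
  [isScalarTower : IsScalarTower k A E]
  [hopfModule : HopfModule k A E]
  /-- The map `N → E`. -/
  i : N →ₗ[A] E
  /-- The map `E → M`. -/
  p : E →ₗ[A] M
  colinear_i : IsColinear k i
  colinear_p : IsColinear k p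
  injective : Function.Injective i
  exact : Function.Exact i p
  surjective : Function.Surjective p

attribute [instance] Extension.addCommGroup Extension.moduleField Extension.moduleRing
  Extension.isScalarTower Extension.hopfModule

variable {k A M N}

namespace Extension

/-- Two extensions are equivalent if there is an isomorphism of Hopf modules between their middle
terms that is compatible with the maps from `N` and to `M`. -/
def Equivalent (X Y : Extension k A M N) : Prop :=
  ∃ φ : X.E ≃ₗ[A] Y.E, IsColinear k (φ : X.E →ₗ[A] Y.E) ∧
    (φ : X.E →ₗ[A] Y.E) ∘ₗ X.i = Y.i ∧ Y.p ∘ₗ (φ : X.E →ₗ[A] Y.E) = X.p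

/-- A morphism of extensions that is the identity on `N` and on `M` is an equivalence. -/
theorem Equivalent.of_hom {X Y : Extension k A M N} (φ : X.E →ₗ[A] Y.E) (hφ : IsColinear k φ)
    (hi : ∀ n, φ (X.i n) = Y.i n) (hp : ∀ e, Y.p (φ e) = X.p e) : X.Equivalent Y := by
  have inj : Function.Injective φ := by
    refine (injective_iff_map_eq_zero φ).2 fun e he => ?_
    have h0 : X.p e = 0 := by rw [← hp, he, map_zero]
    obtain ⟨n, rfl⟩ := (X.exact e).1 h0
    rw [hi] at he
    rw [(injective_iff_map_eq_zero Y.i).1 Y.injective n he, map_zero]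
  have surj : Function.Surjective φ := by
    intro y
    obtain ⟨e, he⟩ := X.surjective (Y.p y)
    have h0 : Y.p (y - φ e) = 0 := by rw [map_sub, hp, he, sub_self]
    obtain ⟨n, hn⟩ := (Y.exact _).1 h0
    exact ⟨X.i n + e, by rw [map_add, hi, hn, sub_add_cancel]⟩
  exact ⟨LinearEquiv.ofBijective φ ⟨inj, surj⟩, hφ, LinearMap.ext hi, LinearMap.ext hp⟩

theorem Equivalent.refl (X : Extension k A M N) : X.Equivalent X :=
  .of_hom LinearMap.id (by
    have e : (LinearMap.id : X.E →ₗ[A] X.E).restrictScalars k = LinearMap.id := rfl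
    rw [IsColinear, e, LinearMap.rTensor_id, LinearMap.comp_id, LinearMap.id_comp])
    (fun _ => rfl) (fun _ => rfl)

theorem Equivalent.symm {X Y : Extension k A M N} (h : X.Equivalent Y) : Y.Equivalent X := by
  obtain ⟨φ, hφ, hi, hp⟩ := h
  refine .of_hom (φ.symm : Y.E →ₗ[A] X.E) ?_ (fun n => ?_) (fun e => ?_)
  · have e1 : ((φ : X.E →ₗ[A] Y.E).restrictScalars k) ∘ₗ
        ((φ.symm : Y.E →ₗ[A] X.E).restrictScalars k) = LinearMap.id := by
      ext; simp
    have e2 : ((φ.symm : Y.E →ₗ[A] X.E).restrictScalars k) ∘ₗ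
        ((φ : X.E →ₗ[A] Y.E).restrictScalars k) = LinearMap.id := by
      ext; simp
    rw [IsColinear] at hφ ⊢
    rw [← LinearMap.comp_id (rho k A Y.E), ← e1, ← LinearMap.comp_assoc _ _ (rho k A Y.E), hφ,
      LinearMap.comp_assoc, ← LinearMap.comp_assoc, ← LinearMap.rTensor_comp, e2,
      LinearMap.rTensor_id, LinearMap.id_comp]
  · rw [LinearEquiv.coe_coe, LinearEquiv.symm_apply_eq]
    exact (LinearMap.congr_fun hi n).symm
  · have := LinearMap.congr_fun hp (φ.symm e)
    simpa using this.symm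

theorem Equivalent.trans {X Y Z : Extension k A M N} (h : X.Equivalent Y) (h' : Y.Equivalent Z) :
    X.Equivalent Z := by
  obtain ⟨φ, hφ, hi, hp⟩ := h
  obtain ⟨ψ, hψ, hi', hp'⟩ := h'
  refine .of_hom ((ψ : Y.E →ₗ[A] Z.E) ∘ₗ (φ : X.E →ₗ[A] Y.E)) ?_ (fun n => ?_) (fun e => ?_)
  · have e : ((ψ : Y.E →ₗ[A] Z.E) ∘ₗ (φ : X.E →ₗ[A] Y.E)).restrictScalars k =
      (ψ : Y.E →ₗ[A] Z.E).restrictScalars k ∘ₗ (φ : X.E →ₗ[A] Y.E).restrictScalars k := rfl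
    rw [IsColinear] at hφ hψ ⊢
    rw [e, ← LinearMap.comp_assoc, hψ, LinearMap.comp_assoc, hφ, LinearMap.rTensor_comp,
      LinearMap.comp_assoc]
  · rw [← hi', ← hi]; rfl
  · rw [← hp, ← hp']; rfl

/-- The map `E × E' → M` whose kernel is the fibre product of `E` and `E'` over `M`. -/
def diff (X Y : Extension k A M N) : X.E × Y.E →ₗ[A] M :=
  X.p ∘ₗ LinearMap.fst A X.E Y.E - Y.p ∘ₗ LinearMap.snd A X.E Y.E

theorem colinear_diff (X Y : Extension k A M N) : IsColinear k (X.diff Y) := by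
  have hx := X.colinear_p
  have hy := Y.colinear_p
  have e1 : (X.diff Y).restrictScalars k ∘ₗ LinearMap.inl k X.E Y.E = X.p.restrictScalars k := by
    ext; simp [diff]
  have e2 : (X.diff Y).restrictScalars k ∘ₗ LinearMap.inr k X.E Y.E =
      -Y.p.restrictScalars k := by
    ext; simp [diff]
  refine LinearMap.ext fun z => ?_
  have hx' := LinearMap.congr_fun hx z.1
  have hy' := LinearMap.congr_fun hy z.2
  simp only [LinearMap.comp_apply, LinearMap.coe_restrictScalars] at hx' hy' ⊢
  rw [rho_prod, map_add, ← LinearMap.rTensor_comp_apply, ← LinearMap.rTensor_comp_apply, e1, e2,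
    LinearMap.rTensor_neg, LinearMap.neg_apply, ← hx', ← hy']
  simp [diff, sub_eq_add_neg]

/-- The fibre product `E ×_M E'` as a Hopf module. -/
abbrev Pullback (X Y : Extension k A M N) : Type u := LinearMap.ker (X.diff Y)

instance (X Y : Extension k A M N) : HopfModule k A (X.Pullback Y) :=
  kerHopf (X.diff Y) (X.colinear_diff Y)

theorem rho_pullback (X Y : Extension k A M N) (z : X.Pullback Y) :
    (kerIncl k (X.diff Y)).rTensor A (rho k A (X.Pullback Y) z) = rho k A (X.E × Y.E) z :=
  LinearMap.congr_fun (kerCoact_spec (X.diff Y) (X.colinear_diff Y)) z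

/-- A map into the fibre product is colinear if it is so as a map into the direct sum. -/
theorem colinear_pullback {Z : Type*} [AddCommGroup Z] [Module k Z] [Module A Z]
    [IsScalarTower k A Z] [HopfModule k A Z] (X Y : Extension k A M N) (f : Z →ₗ[A] X.Pullback Y)
    (h : IsColinear k ((LinearMap.ker (X.diff Y)).subtype ∘ₗ f)) : IsColinear k f := by
  refine LinearMap.ext fun z => kerIncl_rTensor_injective (k := k) (X.diff Y) ?_
  have := LinearMap.congr_fun h z
  simp only [LinearMap.comp_apply, LinearMap.coe_restrictScalars] at this ⊢
  rw [rho_pullback, ← LinearMap.rTensor_comp_apply]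
  exact this

/-- The map `N → E ×_M E'`, `n ↦ (n, -n)`. -/
def anti (X Y : Extension k A M N) : N →ₗ[A] X.Pullback Y :=
  (X.i.prod (-Y.i)).codRestrict _ fun n => by
    simp [diff, (X.exact _).2 ⟨n, rfl⟩, (Y.exact _).2 ⟨n, rfl⟩]

theorem anti_coe (X Y : Extension k A M N) (n : N) :
    (X.anti Y n : X.E × Y.E) = (X.i n, -Y.i n) := rfl

theorem colinear_anti (X Y : Extension k A M N) : IsColinear k (X.anti Y) := by
  refine colinear_pullback X Y _ (LinearMap.ext fun n => ?_)
  have hx' := LinearMap.congr_fun X.colinear_i n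
  have hy' := LinearMap.congr_fun Y.colinear_i n
  have e : ((LinearMap.ker (X.diff Y)).subtype ∘ₗ X.anti Y).restrictScalars k =
      LinearMap.inl k X.E Y.E ∘ₗ X.i.restrictScalars k -
        LinearMap.inr k X.E Y.E ∘ₗ Y.i.restrictScalars k := by
    ext <;> simp [anti_coe]
  simp only [LinearMap.comp_apply, LinearMap.coe_restrictScalars] at hx' hy' ⊢
  rw [e, LinearMap.rTensor_sub, LinearMap.sub_apply, LinearMap.rTensor_comp_apply,
    LinearMap.rTensor_comp_apply, ← hx', ← hy', rho_prod]
  simp [anti_coe, sub_eq_add_neg]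

/-- The middle term of the Baer sum: `E ×_M E'` modulo the `(n, -n)`, `n ∈ N`. -/
abbrev BaerE (X Y : Extension k A M N) : Type u := X.Pullback Y ⧸ LinearMap.range (X.anti Y)

instance (X Y : Extension k A M N) : HopfModule k A (X.BaerE Y) :=
  cokerHopf (X.anti Y) (X.colinear_anti Y)

theorem rho_baer (X Y : Extension k A M N) (z : X.Pullback Y) :
    rho k A (X.BaerE Y) ((LinearMap.range (X.anti Y)).mkQ z) =
      ((LinearMap.range (X.anti Y)).mkQ.restrictScalars k).rTensor A
        (rho k A (X.Pullback Y) z) := rfl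

/-- The map `N → E ×_M E'`, `n ↦ (n, 0)`. -/
def inlN (X Y : Extension k A M N) : N →ₗ[A] X.Pullback Y :=
  (X.i.prod 0).codRestrict _ fun n => by
    simp [diff, (X.exact _).2 ⟨n, rfl⟩]

theorem inlN_coe (X Y : Extension k A M N) (n : N) :
    (X.inlN Y n : X.E × Y.E) = (X.i n, 0) := rfl

theorem colinear_inlN (X Y : Extension k A M N) : IsColinear k (X.inlN Y) := by
  refine colinear_pullback X Y _ (LinearMap.ext fun n => ?_)
  have hx' := LinearMap.congr_fun X.colinear_i n
  have e : ((LinearMap.ker (X.diff Y)).subtype ∘ₗ X.inlN Y).restrictScalars k =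
      LinearMap.inl k X.E Y.E ∘ₗ X.i.restrictScalars k := by
    ext <;> simp [inlN_coe]
  simp only [LinearMap.comp_apply, LinearMap.coe_restrictScalars] at hx' ⊢
  rw [e, LinearMap.rTensor_comp_apply, ← hx', rho_prod]
  simp [inlN_coe]

/-- The map `E ×_M E' → M`. -/
def pullbackP (X Y : Extension k A M N) : X.Pullback Y →ₗ[A] M :=
  X.p ∘ₗ LinearMap.fst A X.E Y.E ∘ₗ (LinearMap.ker (X.diff Y)).subtype

theorem colinear_pullbackP (X Y : Extension k A M N) : IsColinear k (X.pullbackP Y) := by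
  refine LinearMap.ext fun z => ?_
  have hx' := LinearMap.congr_fun X.colinear_p z.1.1
  have e : (X.pullbackP Y).restrictScalars k =
      X.p.restrictScalars k ∘ₗ LinearMap.fst k X.E Y.E ∘ₗ kerIncl k (X.diff Y) := rfl
  simp only [LinearMap.comp_apply, LinearMap.coe_restrictScalars] at hx' ⊢
  rw [e, LinearMap.rTensor_comp_apply, LinearMap.rTensor_comp_apply, rho_pullback, rho_prod,
    map_add, ← LinearMap.rTensor_comp_apply, ← LinearMap.rTensor_comp_apply,
    LinearMap.fst_comp_inl, LinearMap.fst_comp_inr, LinearMap.rTensor_id, LinearMap.rTensor_zero,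
    LinearMap.zero_apply, add_zero, LinearMap.id_apply, ← hx']
  rfl

theorem anti_le_ker (X Y : Extension k A M N) :
    LinearMap.range (X.anti Y) ≤ LinearMap.ker (X.pullbackP Y) := by
  rintro _ ⟨n, rfl⟩
  simp [pullbackP, anti_coe, (X.exact _).2 ⟨n, rfl⟩]

/-- The Baer sum of the extensions `E` and `E'`: the extension
`0 → N → (E ×_M E') / {(n, -n)} → M → 0` with the maps `n ↦ [(n, 0)]` and `[(e, e')] ↦ p e`. -/
def baer (X Y : Extension k A M N) : Extension k A M N where
  E := X.BaerE Y
  i := (LinearMap.range (X.anti Y)).mkQ ∘ₗ X.inlN Y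
  p := (LinearMap.range (X.anti Y)).liftQ (X.pullbackP Y) (X.anti_le_ker Y)
  colinear_i := by
    refine LinearMap.ext fun n => ?_
    have h := LinearMap.congr_fun (X.colinear_inlN Y) n
    have e : ((LinearMap.range (X.anti Y)).mkQ ∘ₗ X.inlN Y).restrictScalars k =
      (LinearMap.range (X.anti Y)).mkQ.restrictScalars k ∘ₗ (X.inlN Y).restrictScalars k := rfl
    simp only [LinearMap.comp_apply, LinearMap.coe_restrictScalars] at h ⊢
    rw [rho_baer, h, e, LinearMap.rTensor_comp_apply]
  colinear_p := by
    refine LinearMap.ext fun w => ?_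
    obtain ⟨z, rfl⟩ := Submodule.mkQ_surjective _ w
    have h := LinearMap.congr_fun (X.colinear_pullbackP Y) z
    have e : ((LinearMap.range (X.anti Y)).liftQ (X.pullbackP Y)
          (X.anti_le_ker Y)).restrictScalars k ∘ₗ
        (LinearMap.range (X.anti Y)).mkQ.restrictScalars k =
      (X.pullbackP Y).restrictScalars k := rfl
    simp only [LinearMap.comp_apply, LinearMap.coe_restrictScalars] at h ⊢
    rw [rho_baer, ← LinearMap.rTensor_comp_apply, e, ← h]
    rfl
  injective := by
    refine (injective_iff_map_eq_zero _).2 fun n hn => ?_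
    obtain ⟨m, hm⟩ := (Submodule.Quotient.mk_eq_zero _).1 hn
    have h2 : -Y.i m = 0 := congrArg (fun z => z.1.2) hm
    have h1 : X.i m = X.i n := congrArg (fun z => z.1.1) hm
    have hm0 : m = 0 := (injective_iff_map_eq_zero Y.i).1 Y.injective m (neg_eq_zero.1 h2)
    rw [← X.injective h1, hm0]
  exact := by
    intro w
    obtain ⟨z, rfl⟩ := Submodule.mkQ_surjective _ w
    have hz : X.p z.1.1 - Y.p z.1.2 = 0 := z.2
    constructor
    · intro h
      have hx : X.p z.1.1 = 0 := h
      have hy : Y.p z.1.2 = 0 := by rw [hx, zero_sub, neg_eq_zero] at hz; exact hz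
      obtain ⟨n, hn⟩ := (X.exact _).1 hx
      obtain ⟨m, hm⟩ := (Y.exact _).1 hy
      refine ⟨n + m, (Submodule.Quotient.eq _).2 ⟨m, Subtype.ext (Prod.ext ?_ ?_)⟩⟩
      · simp [anti_coe, inlN_coe, hn]
      · simp [anti_coe, inlN_coe, hm]
    · rintro ⟨n, hn⟩
      rw [← hn]
      exact (X.exact _).2 ⟨n, rfl⟩
  surjective := by
    intro m
    obtain ⟨e, he⟩ := X.surjective m
    obtain ⟨e', he'⟩ := Y.surjective m
    exact ⟨(LinearMap.range (X.anti Y)).mkQ ⟨(e, e'), by simp [diff, he, he']⟩, he⟩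

theorem baer_congr {X X' Y Y' : Extension k A M N} (hX : X.Equivalent X') (hY : Y.Equivalent Y') :
    (X.baer Y).Equivalent (X'.baer Y') := by
  obtain ⟨φ, hφ, hi, hp⟩ := hX
  obtain ⟨ψ, hψ, hi', hp'⟩ := hY
  replace hi := LinearMap.congr_fun hi
  replace hp := LinearMap.congr_fun hp
  replace hi' := LinearMap.congr_fun hi'
  replace hp' := LinearMap.congr_fun hp'
  let Φ : X.Pullback Y →ₗ[A] X'.Pullback Y' :=
    (((φ : X.E →ₗ[A] X'.E).prodMap (ψ : Y.E →ₗ[A] Y'.E)) ∘ₗ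
      (LinearMap.ker (X.diff Y)).subtype).codRestrict _ fun z => by
        have hz : X.p z.1.1 - Y.p z.1.2 = 0 := z.2
        have h1 : X'.p (φ z.1.1) = X.p z.1.1 := hp _
        have h2 : Y'.p (ψ z.1.2) = Y.p z.1.2 := hp' _
        rw [← h1, ← h2] at hz
        exact hz
  have hΦ : IsColinear k Φ := by
    refine colinear_pullback X' Y' _ (LinearMap.ext fun z => ?_)
    have h1 := LinearMap.congr_fun hφ z.1.1
    have h2 := LinearMap.congr_fun hψ z.1.2
    have e : ((LinearMap.ker (X'.diff Y')).subtype ∘ₗ Φ).restrictScalars k =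
      (((φ : X.E →ₗ[A] X'.E).restrictScalars k).prodMap
        ((ψ : Y.E →ₗ[A] Y'.E).restrictScalars k)) ∘ₗ kerIncl k (X.diff Y) := rfl
    have e1 : (((φ : X.E →ₗ[A] X'.E).restrictScalars k).prodMap
        ((ψ : Y.E →ₗ[A] Y'.E).restrictScalars k)) ∘ₗ LinearMap.inl k X.E Y.E =
        LinearMap.inl k X'.E Y'.E ∘ₗ (φ : X.E →ₗ[A] X'.E).restrictScalars k := by
      ext <;> simp
    have e2 : (((φ : X.E →ₗ[A] X'.E).restrictScalars k).prodMap
        ((ψ : Y.E →ₗ[A] Y'.E).restrictScalars k)) ∘ₗ LinearMap.inr k X.E Y.E =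
        LinearMap.inr k X'.E Y'.E ∘ₗ (ψ : Y.E →ₗ[A] Y'.E).restrictScalars k := by
      ext <;> simp
    rw [LinearMap.comp_apply, LinearMap.comp_apply] at h1 h2
    rw [LinearMap.comp_apply, LinearMap.comp_apply, e, LinearMap.rTensor_comp_apply, rho_pullback,
      rho_prod, rho_prod, map_add, ← LinearMap.rTensor_comp_apply, ← LinearMap.rTensor_comp_apply,
      e1, e2, LinearMap.rTensor_comp_apply, LinearMap.rTensor_comp_apply, ← h1, ← h2]
    rfl
  have hle : LinearMap.range (X.anti Y) ≤
      LinearMap.ker ((LinearMap.range (X'.anti Y')).mkQ ∘ₗ Φ) := by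
    rintro _ ⟨n, rfl⟩
    refine (Submodule.Quotient.mk_eq_zero _).2 ⟨n, Subtype.ext (Prod.ext ?_ ?_)⟩
    · exact (hi n).symm
    · exact (congrArg Neg.neg (hi' n).symm).trans (map_neg ψ _).symm
  refine .of_hom (X := X.baer Y) (Y := X'.baer Y')
    ((LinearMap.range (X.anti Y)).liftQ ((LinearMap.range (X'.anti Y')).mkQ ∘ₗ Φ) hle) ?_ ?_ ?_
  · refine LinearMap.ext fun w => ?_
    obtain ⟨z, rfl⟩ := Submodule.mkQ_surjective _ w
    have h := LinearMap.congr_fun hΦ z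
    have e : ((LinearMap.range (X.anti Y)).liftQ ((LinearMap.range (X'.anti Y')).mkQ ∘ₗ Φ)
          hle).restrictScalars k ∘ₗ (LinearMap.range (X.anti Y)).mkQ.restrictScalars k =
        (LinearMap.range (X'.anti Y')).mkQ.restrictScalars k ∘ₗ Φ.restrictScalars k := rfl
    rw [LinearMap.comp_apply, LinearMap.comp_apply] at h
    have h3 := rho_baer X' Y' (Φ z)
    refine h3.trans ?_
    refine (congrArg _ h).trans ?_
    rw [← LinearMap.rTensor_comp_apply, ← e, LinearMap.rTensor_comp_apply]
    rfl
  · intro n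
    refine congrArg (LinearMap.range (X'.anti Y')).mkQ (Subtype.ext (Prod.ext ?_ ?_))
    · exact hi n
    · exact map_zero ψ
  · intro w
    obtain ⟨z, rfl⟩ := Submodule.mkQ_surjective _ w
    exact hp z.1.1

end Extension

variable (k A M N)

/-- Equivalence of extensions. -/
def extensionSetoid : Setoid (Extension k A M N) where
  r := Extension.Equivalent
  iseqv := ⟨.refl, .symm, .trans⟩

/-- `Ext¹(M, N)`: the equivalence classes of extensions of `M` by `N` in the category of
left-right Hopf modules. -/
def Ext1 := Quotient (extensionSetoid k A M N)

/-- The group law of `Ext¹(M, N)` is the Baer sum. -/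
instance : Add (Ext1 k A M N) where
  add := Quotient.map₂ Extension.baer fun _ _ h _ _ h' => Extension.baer_congr h h'

end ext

end

end HopfCoh

namespace HopfCoh

noncomputable section

/-! Extensions are compared with cocycles by choosing a `k`-linear section `s` of `0 → N → E → M →
0`. Its failure to be `A`-linear, `ω_E ∘ (id ⊗ s) - s ∘ ω_M`, and its failure to be colinear, `ρ_E ∘
s - (s ⊗ id) ∘ ρ_M`, land in `N` and `N ⊗ A` and give a pair `(ω', ρ')`. Associativity of the
action, coassociativity of the coaction and Hopf compatibility on `E`, read along `s`, are exactly
the three equations of `Z¹(M, N)` (`IsSection.mem_Z1`). Two sections of one extension differ by some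
`f : M → N`, and the pair then changes by the coboundary of `f` (`IsSection.sub_mem_B1`).

Conversely, a cocycle twists the direct sum `N ⊕ M` into a Hopf module `TwistedSum z`, whose
inclusion of `M` is a section with cocycle `z`. Unit and counit laws are not among the three
equations but follow from them (`Z1.apply_one`, `Z1.counit_comp_eq_zero`). Every extension is
equivalent to such a twisted sum (`IsSection.equivalent`), and two of these are equivalent precisely
when their cocycles are cohomologous (`twistedSum_equivalent_iff`), so `Z¹/B¹ → Ext¹` is a
bijection. Pairing sections of `E` and `E'` gives a section of the Baer sum whose cocycle is the sum
(`IsSection.baer`), so the bijection is additive; being additive from a group, it also shows that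
the Baer sum is a group law.

The identification of `H¹` with `Z¹/B¹` is an unwinding of the total complex in degrees `0`, `1`,
`2`: the components of the differential of a `1`-cochain in bidegrees `(2,0)`, `(0,2)`, `(1,1)` are
the three cocycle equations (`mem_Z1_iff`). -/

theorem alternating_sum_range_two {k V W : Type*} [Field k] [AddCommGroup V] [Module k V]
    [AddCommGroup W] [Module k W] (g : ℕ → V →ₗ[k] W) (v : V) :
    (∑ i ∈ Finset.range 2, (-1 : k) ^ i • g i) v = g 0 v - g 1 v := by
  simp [Finset.sum_range_succ, sub_eq_add_neg]

/-- The positive terms come first, and `g 2` before `g 0`, to reproduce the order of the terms in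
the cocycle equations. -/
theorem alternating_sum_range_three {k V W : Type*} [Field k] [AddCommGroup V] [Module k V]
    [AddCommGroup W] [Module k W] (g : ℕ → V →ₗ[k] W) (v : V) :
    (∑ i ∈ Finset.range 3, (-1 : k) ^ i • g i) v = g 2 v + g 0 v - g 1 v := by
  simp [Finset.sum_range_succ]
  abel

/-! ### The total complex in degrees at most two -/

section lowDegree

variable {k : Type v} {A M N : Type u} [Field k] [Ring A] [Bialgebra k A]
  [AddCommGroup M] [Module k M] [Module A M] [IsScalarTower k A M]
  [AddCommGroup N] [Module k N] [Module A N] [IsScalarTower k A N]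

theorem dm_zero_zero (f : M →ₗ[k] N) :
    (dm k A M N 0 0 f : A ⊗[k] M →ₗ[k] N) = omega k A N ∘ₗ f.lTensor A - f ∘ₗ omega k A M := by
  have : dm k A M N 0 0 f = b k A M N 0 0 0 f - b k A M N 0 0 1 f :=
    alternating_sum_range_two _ f
  rw [this]; rfl

theorem dm_one_zero (f : A ⊗[k] M →ₗ[k] N) :
    (dm k A M N 1 0 f : A ⊗[k] (A ⊗[k] M) →ₗ[k] N) =
      f ∘ₗ (omega k A M).lTensor A + omega k A N ∘ₗ f.lTensor A -
      f ∘ₗ (LinearMap.mul' k A).rTensor M ∘ₗ (TensorProduct.assoc k A A M).symm.toLinearMap := by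
  have : dm k A M N 1 0 f = b k A M N 1 0 2 f + b k A M N 1 0 0 f - b k A M N 1 0 1 f :=
    alternating_sum_range_three _ f
  rw [this]; rfl

theorem dm_zero_one (f : M →ₗ[k] N ⊗[k] A) :
    (dm k A M N 0 1 f : A ⊗[k] M →ₗ[k] N ⊗[k] A) =
      twist (omega k A N) f - f ∘ₗ omega k A M := by
  have : dm k A M N 0 1 f = b k A M N 0 1 0 f - b k A M N 0 1 1 f :=
    alternating_sum_range_two _ f
  -- The diagonal action on `N ⊗ A` is `twist` of `ω_N` with the identity; precomposing it with `id
  -- ⊗ f` replaces that identity by `f`.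
  rw [this, ← LinearMap.id_comp f, twist_comp, LinearMap.id_comp]; rfl

variable [HopfModule k A M] [HopfModule k A N]

theorem dc_zero_zero (f : M →ₗ[k] N) :
    (dc k A M N 0 0 f : M →ₗ[k] N ⊗[k] A) = rho k A N ∘ₗ f - f.rTensor A ∘ₗ rho k A M := by
  have : dc k A M N 0 0 f = c k A M N 0 0 0 f - c k A M N 0 0 1 f :=
    alternating_sum_range_two _ f
  rw [this]; rfl

theorem dc_one_zero (f : A ⊗[k] M →ₗ[k] N) :
    (dc k A M N 1 0 f : A ⊗[k] M →ₗ[k] N ⊗[k] A) =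
      rho k A N ∘ₗ f - twist f (rho k A M) := by
  have : dc k A M N 1 0 f = c k A M N 1 0 0 f - c k A M N 1 0 1 f :=
    alternating_sum_range_two _ f
  -- Dually, the codiagonal coaction on `A ⊗ M` is `twist` of the identity with `ρ_M`; following it
  -- by `f ⊗ id` replaces that identity by `f`.
  rw [this, ← LinearMap.comp_id f, ← rTensor_comp_twist, LinearMap.comp_id]; rfl

theorem dc_zero_one (f : M →ₗ[k] N ⊗[k] A) :
    (dc k A M N 0 1 f : M →ₗ[k] (N ⊗[k] A) ⊗[k] A) =
      f.rTensor A ∘ₗ rho k A M + (rho k A N).rTensor A ∘ₗ f -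
      (TensorProduct.assoc k N A A).symm.toLinearMap ∘ₗ
        (Coalgebra.comul (R := k) (A := A)).lTensor N ∘ₗ f := by
  have : dc k A M N 0 1 f = c k A M N 0 1 2 f + c k A M N 0 1 0 f - c k A M N 0 1 1 f :=
    alternating_sum_range_three _ f
  rw [this]; rfl

variable (k A M N) in
/-- The isomorphism of the total complex in degree `1` with `C^{1,0} ⊕ C^{0,1}`. -/
def totOneEquiv : Tot k A M N 1 ≃ₗ[k] (A ⊗[k] M →ₗ[k] N) × (M →ₗ[k] N ⊗[k] A) where
  toFun z := (z ⟨(1, 0), rfl⟩, z ⟨(0, 1), rfl⟩)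
  map_add' _ _ := rfl
  map_smul' _ _ := rfl
  invFun w
    | ⟨(1, 0), _⟩ => w.1
    | ⟨(0, 1), _⟩ => w.2
    | ⟨(0, 0), h⟩ => absurd h (by simp)
    | ⟨(0, n + 2), h⟩ => absurd h (by simp)
    | ⟨(1, n + 1), h⟩ => absurd h (by simp)
    | ⟨(n + 2, m), h⟩ => absurd h (by simp; omega)
  left_inv z := by
    funext x
    match x with
    | ⟨(1, 0), _⟩ => rfl
    | ⟨(0, 1), _⟩ => rfl
    | ⟨(0, 0), h⟩ => exact absurd h (by simp)
    | ⟨(0, n + 2), h⟩ => exact absurd h (by simp)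
    | ⟨(1, n + 1), h⟩ => exact absurd h (by simp)
    | ⟨(n + 2, m), h⟩ => exact absurd h (by simp; omega)
  right_inv _ := rfl

theorem totD_one_apply_two_zero (z : Tot k A M N 1) :
    totD k A M N 1 z ⟨(2, 0), rfl⟩ = dm k A M N 1 0 (z ⟨(1, 0), rfl⟩) :=
  add_zero _

/-- The minus sign is `(-1)^n` at `n = 1`. It makes the vanishing of this mixed component the Hopf
compatibility equation. -/
theorem totD_one_apply_one_one (z : Tot k A M N 1) :
    totD k A M N 1 z ⟨(1, 1), rfl⟩ =
      dm k A M N 0 1 (z ⟨(0, 1), rfl⟩) - dc k A M N 1 0 (z ⟨(1, 0), rfl⟩) := by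
  have : totD k A M N 1 z ⟨(1, 1), rfl⟩ = dm k A M N 0 1 (z ⟨(0, 1), rfl⟩) +
    (-1 : k) ^ 1 • dc k A M N 1 0 (z ⟨(1, 0), rfl⟩) := rfl
  rw [this, pow_one, neg_one_smul, sub_eq_add_neg]

theorem totD_one_apply_zero_two (z : Tot k A M N 1) :
    totD k A M N 1 z ⟨(0, 2), rfl⟩ = dc k A M N 0 1 (z ⟨(0, 1), rfl⟩) := by
  refine (zero_add _).trans ?_
  exact (congrArg (· • dc k A M N 0 1 (z ⟨(0, 1), rfl⟩)) (pow_zero (-1 : k))).trans (one_smul k _)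

/-- Only the bidegrees `(2,0)`, `(1,1)` and `(0,2)` occur in total degree `2`, so the vanishing of
the differential is three equations. -/
theorem totD_one_eq_zero_iff (z : Tot k A M N 1) :
    totD k A M N 1 z = 0 ↔ dm k A M N 1 0 (z ⟨(1, 0), rfl⟩) = 0 ∧
      dc k A M N 0 1 (z ⟨(0, 1), rfl⟩) = 0 ∧
      dm k A M N 0 1 (z ⟨(0, 1), rfl⟩) = dc k A M N 1 0 (z ⟨(1, 0), rfl⟩) := by
  rw [← totD_one_apply_two_zero, ← totD_one_apply_zero_two, ← sub_eq_zero (b := dc k A M N 1 0 _),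
    ← totD_one_apply_one_one]
  refine ⟨fun h => by rw [h]; exact ⟨rfl, rfl, rfl⟩, fun ⟨h1, h2, h3⟩ => ?_⟩
  funext x
  match x with
  | ⟨(2, 0), _⟩ => exact h1
  | ⟨(0, 2), _⟩ => exact h2
  | ⟨(1, 1), _⟩ => exact h3
  | ⟨(0, 0), h⟩ => exact absurd h (by simp)
  | ⟨(0, 1), h⟩ => exact absurd h (by simp)
  | ⟨(1, 0), h⟩ => exact absurd h (by simp)
  | ⟨(0, n + 3), h⟩ => exact absurd h (by simp)
  | ⟨(1, n + 2), h⟩ => exact absurd h (by simp; omega)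
  | ⟨(2, n + 1), h⟩ => exact absurd h (by simp)
  | ⟨(n + 3, m), h⟩ => exact absurd h (by simp; omega)

/-- The three conditions correspond one by one: `(2,0)` says that the action deforms associatively,
`(0,2)` that the coaction deforms coassociatively, and `(1,1)` that the two stay compatible. -/
theorem mem_Z1_iff (f : A ⊗[k] M →ₗ[k] N) (g : M →ₗ[k] N ⊗[k] A) :
    (f, g) ∈ Z1 k A M N ↔ dm k A M N 1 0 f = 0 ∧ dc k A M N 0 1 g = 0 ∧
      dm k A M N 0 1 g = dc k A M N 1 0 f := by
  refine and_congr ?_ (and_congr ?_ ?_)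
  · refine sub_eq_zero.symm.trans (Eq.congr ?_ rfl)
    exact (dm_one_zero f).symm
  · refine Iff.symm ((Eq.congr (dc_zero_one g) rfl).trans (sub_eq_zero.trans ?_))
    -- The complex brackets its target as `(N ⊗ A) ⊗ A`, whereas `Z1` compares in `N ⊗ (A ⊗ A)`; the
    -- associator moves across the equation.
    exact LinearEquiv.eq_toLinearMap_symm_comp _ _
  · refine Iff.symm ((Eq.congr (dm_zero_one g) (dc_one_zero f)).trans ?_)
    exact sub_eq_sub_iff_add_eq_add.trans (Eq.congr (add_comm _ _) (add_comm _ _))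

theorem totOneEquiv_mem_Z1_iff (z : Tot k A M N 1) :
    totOneEquiv k A M N z ∈ Z1 k A M N ↔ totD k A M N 1 z = 0 :=
  (mem_Z1_iff _ _).trans (totD_one_eq_zero_iff z).symm

theorem totOneEquiv_totD (z : Tot k A M N 0) (f : M →ₗ[k] N) (hf : z ⟨(0, 0), rfl⟩ = f) :
    totOneEquiv k A M N (totD k A M N 0 z) =
      (omega k A N ∘ₗ f.lTensor A - f ∘ₗ omega k A M,
        rho k A N ∘ₗ f - f.rTensor A ∘ₗ rho k A M) := by
  refine Prod.ext ((add_zero _).trans ((congrArg (dm k A M N 0 0) hf).trans (dm_zero_zero f)))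
    ((zero_add _).trans (Eq.trans ?_ (dc_zero_zero f)))
  exact ((congrArg (· • dc k A M N 0 0 (z ⟨(0, 0), rfl⟩)) (pow_zero (-1 : k))).trans
    (one_smul k _)).trans (congrArg (dc k A M N 0 0) hf)

theorem totOneEquiv_mem_B1_iff (z : Tot k A M N 1) :
    totOneEquiv k A M N z ∈ B1 k A M N ↔ z ∈ totB k A M N 1 := by
  constructor
  · rintro ⟨f, hf⟩
    let g : Tot k A M N 0 := fun
      | ⟨(0, 0), _⟩ => f
      | ⟨(0, n + 1), h⟩ => absurd h (by simp)
      | ⟨(n + 1, m), h⟩ => absurd h (by simp)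
    exact ⟨g, (totOneEquiv k A M N).injective ((totOneEquiv_totD g f rfl).trans hf.symm)⟩
  · rintro ⟨f, rfl⟩
    exact ⟨f ⟨(0, 0), rfl⟩, totOneEquiv_totD f _ rfl⟩

variable (k A M N) in
/-- The `1`-cocycles of the total complex are the pairs in `Z¹(M, N)`. -/
def kerTotDOneEquiv : LinearMap.ker (totD k A M N 1) ≃ₗ[k] Z1 k A M N :=
  (totOneEquiv k A M N).ofSubmodules _ _ (by
    ext w
    rw [Submodule.mem_map_equiv, LinearMap.mem_ker, ← totOneEquiv_mem_Z1_iff,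
      LinearEquiv.apply_symm_apply])

variable (k A M N) in
/-- `H¹(M, N) = Z¹(M, N) / B¹(M, N)`. -/
def hOneEquiv : H k A M N 1 ≃ₗ[k] Z1 k A M N ⧸ (B1 k A M N).submoduleOf (Z1 k A M N) :=
  -- Both denominators are preimages of coboundaries inside the cocycles, so matching them needs
  -- only the comparison of `B1` with the image of the differential, and not that the differential
  -- squares to zero.
  Submodule.Quotient.equiv _ _ (kerTotDOneEquiv k A M N) (by
    ext w
    rw [Submodule.mem_map_equiv]
    refine (totOneEquiv_mem_B1_iff _).symm.trans (Eq.to_iff (congrArg (· ∈ B1 k A M N) ?_))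
    exact congrArg Subtype.val ((kerTotDOneEquiv k A M N).apply_symm_apply w))

end lowDegree

/-! ### Additivity and naturality of the structure maps -/

section twistAdd

variable {k A X Y L : Type*} [Field k] [Ring A] [Bialgebra k A]
  [AddCommGroup X] [Module k X] [AddCommGroup Y] [Module k Y] [AddCommGroup L] [Module k L]

theorem twist_add_left (α β : A ⊗[k] X →ₗ[k] Y) (γ : L →ₗ[k] X ⊗[k] A) :
    twist (α + β) γ = twist α γ + twist β γ := by
  simp only [twist, TensorProduct.map_add_left, LinearMap.add_comp]

theorem twist_add_right (α : A ⊗[k] X →ₗ[k] Y) (γ δ : L →ₗ[k] X ⊗[k] A) :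
    twist α (γ + δ) = twist α γ + twist α δ := by
  simp only [twist, TensorProduct.map_add_right, LinearMap.comp_add]

theorem rTensor_comp_assoc (g : X →ₗ[k] Y) :
    g.rTensor (A ⊗[k] A) ∘ₗ (TensorProduct.assoc k X A A).toLinearMap =
      (TensorProduct.assoc k Y A A).toLinearMap ∘ₗ (g.rTensor A).rTensor A :=
  TensorProduct.ext_threefold fun _ _ _ => by simp

theorem comp_rid (g : X →ₗ[k] Y) :
    g ∘ₗ (TensorProduct.rid k X).toLinearMap =
      (TensorProduct.rid k Y).toLinearMap ∘ₗ g.rTensor k :=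
  TensorProduct.ext' fun _ _ => by simp

end twistAdd

/-! ### Structure equations along a map that is linear and colinear only up to a cocycle -/

section skewSection

variable {k A E M N : Type*} [Field k] [Ring A] [Bialgebra k A]
  [AddCommGroup E] [Module k E] [AddCommGroup M] [Module k M] [AddCommGroup N] [Module k N]
  {i : N →ₗ[k] E} {s : M →ₗ[k] E} {κ : E →ₗ[k] E ⊗[k] A} {ρN : N →ₗ[k] N ⊗[k] A}
  {ρM : M →ₗ[k] M ⊗[k] A} {ρ' : M →ₗ[k] N ⊗[k] A}
  {α : A ⊗[k] E →ₗ[k] E} {αN : A ⊗[k] N →ₗ[k] N} {αM : A ⊗[k] M →ₗ[k] M}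
  {ω' : A ⊗[k] M →ₗ[k] N}

/-- Expanding `κ` twice along `s` leaves an `s`-part governed by `ρM` alone, and an `i`-part which
is the left side of the second cocycle equation. Nothing is assumed of `κ`, `ρ'` or `ρM` beyond the
two expansions, so the same computation serves to build the twisted sum and to extract a cocycle
from a given extension. -/
theorem assoc_rTensor_skew (hi : κ ∘ₗ i = i.rTensor A ∘ₗ ρN)
    (hs : κ ∘ₗ s = i.rTensor A ∘ₗ ρ' + s.rTensor A ∘ₗ ρM) :
    ((TensorProduct.assoc k E A A).toLinearMap ∘ₗ κ.rTensor A ∘ₗ κ) ∘ₗ s =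
      i.rTensor (A ⊗[k] A) ∘ₗ (TensorProduct.assoc k N A A).toLinearMap ∘ₗ
        (ρ'.rTensor A ∘ₗ ρM + ρN.rTensor A ∘ₗ ρ') +
      s.rTensor (A ⊗[k] A) ∘ₗ (TensorProduct.assoc k M A A).toLinearMap ∘ₗ ρM.rTensor A ∘ₗ ρM := by
  rw [← LinearMap.comp_assoc _ _ (i.rTensor _), ← LinearMap.comp_assoc _ _ (s.rTensor _), rTensor_comp_assoc,
    rTensor_comp_assoc]
  simp only [LinearMap.comp_assoc]
  rw [hs, ← LinearMap.comp_add]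
  congr 1
  rw [LinearMap.comp_add, ← LinearMap.comp_assoc, ← LinearMap.rTensor_comp, hi,
    ← LinearMap.comp_assoc, ← LinearMap.rTensor_comp, hs, LinearMap.rTensor_comp,
    LinearMap.rTensor_add, LinearMap.rTensor_comp, LinearMap.rTensor_comp]
  simp only [LinearMap.comp_assoc, LinearMap.add_comp, LinearMap.comp_add]
  abel

theorem lTensor_comul_skew (hs : κ ∘ₗ s = i.rTensor A ∘ₗ ρ' + s.rTensor A ∘ₗ ρM) :
    ((Coalgebra.comul (R := k) (A := A)).lTensor E ∘ₗ κ) ∘ₗ s =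
      i.rTensor (A ⊗[k] A) ∘ₗ (Coalgebra.comul (R := k) (A := A)).lTensor N ∘ₗ ρ' +
      s.rTensor (A ⊗[k] A) ∘ₗ (Coalgebra.comul (R := k) (A := A)).lTensor M ∘ₗ ρM := by
  rw [LinearMap.comp_assoc, hs, LinearMap.comp_add]
  simp only [← LinearMap.comp_assoc, LinearMap.lTensor_comp_rTensor, LinearMap.rTensor_comp_lTensor]

theorem counit_skew (hs : κ ∘ₗ s = i.rTensor A ∘ₗ ρ' + s.rTensor A ∘ₗ ρM) :
    ((TensorProduct.rid k E).toLinearMap ∘ₗ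
        (Coalgebra.counit (R := k) (A := A)).lTensor E ∘ₗ κ) ∘ₗ s =
      i ∘ₗ (TensorProduct.rid k N).toLinearMap ∘ₗ
        (Coalgebra.counit (R := k) (A := A)).lTensor N ∘ₗ ρ' +
      s ∘ₗ (TensorProduct.rid k M).toLinearMap ∘ₗ
        (Coalgebra.counit (R := k) (A := A)).lTensor M ∘ₗ ρM := by
  rw [← LinearMap.comp_assoc _ _ i, ← LinearMap.comp_assoc _ _ s, comp_rid, comp_rid]
  simp only [LinearMap.comp_assoc]
  rw [hs, ← LinearMap.comp_add]
  congr 1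
  rw [LinearMap.comp_add]
  simp only [← LinearMap.comp_assoc, LinearMap.lTensor_comp_rTensor, LinearMap.rTensor_comp_lTensor]

/-- The `i`-part here is the right side of the third cocycle equation; in `twist_skew` it is the
left side. Hopf compatibility of `E` along `s` is the equality of the two. -/
theorem comp_action_skew (hi : κ ∘ₗ i = i.rTensor A ∘ₗ ρN)
    (hs : κ ∘ₗ s = i.rTensor A ∘ₗ ρ' + s.rTensor A ∘ₗ ρM)
    (ha : α ∘ₗ s.lTensor A = i ∘ₗ ω' + s ∘ₗ αM) :
    (κ ∘ₗ α) ∘ₗ s.lTensor A =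
      i.rTensor A ∘ₗ (ρ' ∘ₗ αM + ρN ∘ₗ ω') + s.rTensor A ∘ₗ ρM ∘ₗ αM := by
  rw [LinearMap.comp_assoc, ha, LinearMap.comp_add, ← LinearMap.comp_assoc, hi,
    ← LinearMap.comp_assoc, hs]
  simp only [LinearMap.comp_assoc, LinearMap.add_comp, LinearMap.comp_add]
  abel

theorem twist_skew (hs : κ ∘ₗ s = i.rTensor A ∘ₗ ρ' + s.rTensor A ∘ₗ ρM)
    (hai : α ∘ₗ i.lTensor A = i ∘ₗ αN) (ha : α ∘ₗ s.lTensor A = i ∘ₗ ω' + s ∘ₗ αM) :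
    twist α κ ∘ₗ s.lTensor A =
      i.rTensor A ∘ₗ (twist ω' ρM + twist αN ρ') + s.rTensor A ∘ₗ twist αM ρM := by
  rw [← twist_comp, hs, twist_add_right, ← twist_lTensor, ← twist_lTensor, hai, ha, twist_add_left,
    LinearMap.comp_add, rTensor_comp_twist, rTensor_comp_twist, rTensor_comp_twist]
  abel

end skewSection

/-! ### The extension built from a cocycle -/

section twistedSum

variable {k : Type v} {A M N : Type u} [Field k] [Ring A] [Bialgebra k A]
  [AddCommGroup M] [Module k M] [Module A M] [IsScalarTower k A M] [HopfModule k A M]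
  [AddCommGroup N] [Module k N] [Module A N] [IsScalarTower k A N] [HopfModule k A N]

variable (k A) in
/-- The map `id ⊗ ε : X ⊗ A → X`. -/
abbrev contractRight (X : Type*) [AddCommGroup X] [Module k X] : X ⊗[k] A →ₗ[k] X :=
  (TensorProduct.rid k X).toLinearMap ∘ₗ (Coalgebra.counit (R := k) (A := A)).lTensor X

theorem contractRight_comp_rTensor {X Y : Type*} [AddCommGroup X] [Module k X] [AddCommGroup Y]
    [Module k Y] (f : X →ₗ[k] Y) :
    contractRight k A Y ∘ₗ f.rTensor A = f ∘ₗ contractRight k A X :=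
  TensorProduct.ext' fun _ _ => by simp

theorem contractRight_comp_rho {X : Type*} [AddCommGroup X] [Module k X] [RightComodule k A X] :
    contractRight k A X ∘ₗ rho k A X = LinearMap.id :=
  RightComodule.coact_counit

/-- This is the counit law of `A`, applied to the last factor and rebracketed. -/
theorem contractRight_assoc_symm_comul {X : Type*} [AddCommGroup X] [Module k X] :
    contractRight k A (X ⊗[k] A) ∘ₗ (TensorProduct.assoc k X A A).symm.toLinearMap ∘ₗ
      (Coalgebra.comul (R := k) (A := A)).lTensor X = LinearMap.id := by
  have h : contractRight k A (X ⊗[k] A) ∘ₗ (TensorProduct.assoc k X A A).symm.toLinearMap =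
      (contractRight k A A).lTensor X := by
    refine TensorProduct.ext (LinearMap.ext fun x => TensorProduct.ext' fun a b => ?_)
    simp
  rw [← LinearMap.comp_assoc, h, ← LinearMap.lTensor_comp, LinearMap.comp_assoc,
    Coalgebra.lTensor_counit_comp_comul]
  refine TensorProduct.ext' fun x a => ?_
  simp

theorem Z1.apply_mul (z : Z1 k A M N) (a b : A) (m : M) :
    z.1.1 ((a * b) ⊗ₜ m) = z.1.1 (a ⊗ₜ (b • m)) + a • z.1.1 (b ⊗ₜ m) := by
  have := LinearMap.congr_fun z.2.1 (a ⊗ₜ (b ⊗ₜ m))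
  simpa using this.symm

/-- A derivation kills the unit: the first cocycle equation at `1 * 1` reads `x = x + x`. -/
theorem Z1.apply_one (z : Z1 k A M N) (m : M) : z.1.1 (1 ⊗ₜ m) = 0 := by
  have := Z1.apply_mul z 1 1 m
  rwa [one_mul, one_smul, one_smul, left_eq_add] at this

/-- This is dual to the vanishing at the unit. Applying `ε` to the last factor of the second cocycle
equation turns it into `ρ' + ρ_N ∘ (id ⊗ ε) ∘ ρ' = ρ'`, and `ρ_N` has the left inverse `id ⊗ ε`. -/
theorem Z1.counit_comp_eq_zero (z : Z1 k A M N) :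
    (TensorProduct.rid k N).toLinearMap ∘ₗ
      (Coalgebra.counit (R := k) (A := A)).lTensor N ∘ₗ z.1.2 = 0 := by
  have h : z.1.2.rTensor A ∘ₗ rho k A M + (rho k A N).rTensor A ∘ₗ z.1.2 =
      (TensorProduct.assoc k N A A).symm.toLinearMap ∘ₗ
        (Coalgebra.comul (R := k) (A := A)).lTensor N ∘ₗ z.1.2 :=
    (LinearEquiv.eq_toLinearMap_symm_comp _ _).2 z.2.2.1
  have h' := congrArg (fun f => contractRight k A (N ⊗[k] A) ∘ₗ f) h
  rw [LinearMap.comp_add, ← LinearMap.comp_assoc, ← LinearMap.comp_assoc,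
    contractRight_comp_rTensor, contractRight_comp_rTensor, LinearMap.comp_assoc,
    contractRight_comp_rho, LinearMap.comp_id, ← LinearMap.comp_assoc z.1.2,
    ← LinearMap.comp_assoc z.1.2, contractRight_assoc_symm_comul, LinearMap.id_comp,
    add_eq_left, LinearMap.comp_assoc] at h'
  have h2 := congrArg (fun f => contractRight k A N ∘ₗ f) h'
  rwa [← LinearMap.comp_assoc, contractRight_comp_rho, LinearMap.id_comp,
    LinearMap.comp_zero] at h2

/-- The space `N ⊕ M` with the Hopf module structure twisted by a cocycle. -/
def TwistedSum (_z : Z1 k A M N) : Type u := N × M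

namespace TwistedSum

variable (z : Z1 k A M N)

instance : AddCommGroup (TwistedSum z) := inferInstanceAs (AddCommGroup (N × M))

instance : Module k (TwistedSum z) := inferInstanceAs (Module k (N × M))

/-- The inclusion of `N`, as a linear map. -/
def inl : N →ₗ[k] TwistedSum z := LinearMap.inl k N M

/-- The inclusion of `M`, as a linear map. -/
def inr : M →ₗ[k] TwistedSum z := LinearMap.inr k N M

/-- The linear map out of a twisted sum with given components. -/
def coprod {X : Type*} [AddCommGroup X] [Module k X] (f : N →ₗ[k] X) (g : M →ₗ[k] X) :
    TwistedSum z →ₗ[k] X := LinearMap.coprod f g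

@[simp]
theorem coprod_comp_inl {X : Type*} [AddCommGroup X] [Module k X] (f : N →ₗ[k] X)
    (g : M →ₗ[k] X) : coprod z f g ∘ₗ inl z = f := LinearMap.coprod_inl f g

@[simp]
theorem coprod_comp_inr {X : Type*} [AddCommGroup X] [Module k X] (f : N →ₗ[k] X)
    (g : M →ₗ[k] X) : coprod z f g ∘ₗ inr z = g := LinearMap.coprod_inr f g

@[simp]
theorem coprod_inl_apply {X : Type*} [AddCommGroup X] [Module k X] (f : N →ₗ[k] X)
    (g : M →ₗ[k] X) (n : N) : coprod z f g (inl z n) = f n :=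
  LinearMap.congr_fun (coprod_comp_inl z f g) n

@[simp]
theorem coprod_inr_apply {X : Type*} [AddCommGroup X] [Module k X] (f : N →ₗ[k] X)
    (g : M →ₗ[k] X) (m : M) : coprod z f g (inr z m) = g m :=
  LinearMap.congr_fun (coprod_comp_inr z f g) m

variable {z} in
theorem exists_eq (x : TwistedSum z) : ∃ n m, x = inl z n + inr z m :=
  ⟨x.1, x.2, Prod.ext (add_zero _).symm (zero_add _).symm⟩

variable {z} in
theorem hom_ext {X : Type*} [AddCommGroup X] [Module k X] {f g : TwistedSum z →ₗ[k] X}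
    (hl : f ∘ₗ inl z = g ∘ₗ inl z) (hr : f ∘ₗ inr z = g ∘ₗ inr z) : f = g :=
  LinearMap.prod_ext hl hr

/-- This differs from the direct-sum action already carried by `N × M`, hence the separate type:
`inl` remains `A`-linear, and `inr` fails to be so by exactly `ω'`. -/
instance : SMul A (TwistedSum z) :=
  ⟨fun a => coprod z (inl z ∘ₗ Algebra.lsmul k k N a)
    (inl z ∘ₗ z.1.1 ∘ₗ TensorProduct.mk k A M a + inr z ∘ₗ Algebra.lsmul k k M a)⟩

theorem smul_def (a : A) (x : TwistedSum z) : a • x =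
    coprod z (inl z ∘ₗ Algebra.lsmul k k N a)
    (inl z ∘ₗ z.1.1 ∘ₗ TensorProduct.mk k A M a + inr z ∘ₗ Algebra.lsmul k k M a) x := rfl

@[simp]
theorem smul_inl (a : A) (n : N) : a • inl z n = inl z (a • n) := by
  simp [smul_def]

@[simp]
theorem smul_inr (a : A) (m : M) : a • inr z m = inl z (z.1.1 (a ⊗ₜ m)) + inr z (a • m) := by
  simp [smul_def]

instance : DistribSMul A (TwistedSum z) where
  smul_zero _ := map_zero _
  smul_add _ x y := map_add _ x y

instance : Module A (TwistedSum z) where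
  one_smul x := by
    obtain ⟨n, m, rfl⟩ := exists_eq x
    simp [Z1.apply_one]
  mul_smul a b x := by
    obtain ⟨n, m, rfl⟩ := exists_eq x
    simp only [smul_add, smul_inl, smul_inr, Z1.apply_mul, map_add, mul_smul]
    abel
  smul_zero a := smul_zero a
  smul_add a x y := smul_add a x y
  zero_smul x := by
    obtain ⟨n, m, rfl⟩ := exists_eq x
    simp
  add_smul a b x := by
    obtain ⟨n, m, rfl⟩ := exists_eq x
    simp only [smul_add, smul_inl, smul_inr, add_smul, map_add, TensorProduct.add_tmul]
    abel

instance : IsScalarTower k A (TwistedSum z) where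
  smul_assoc r a x := by
    obtain ⟨n, m, rfl⟩ := exists_eq x
    simp only [smul_add, smul_inl, smul_inr, smul_assoc, map_smul,
      ← TensorProduct.smul_tmul']

theorem omega_comp_inl :
    omega k A (TwistedSum z) ∘ₗ (inl z).lTensor A = inl z ∘ₗ omega k A N :=
  TensorProduct.ext' fun a n => by simp

theorem omega_comp_inr : omega k A (TwistedSum z) ∘ₗ (inr z).lTensor A =
    inl z ∘ₗ z.1.1 + inr z ∘ₗ omega k A M :=
  TensorProduct.ext' fun a n => by simp

theorem tensor_hom_ext {X : Type*} [AddCommGroup X] [Module k X]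
    {f g : A ⊗[k] TwistedSum z →ₗ[k] X} (hl : f ∘ₗ (inl z).lTensor A = g ∘ₗ (inl z).lTensor A)
    (hr : f ∘ₗ (inr z).lTensor A = g ∘ₗ (inr z).lTensor A) : f = g :=
  TensorProduct.ext' fun a x => by
    obtain ⟨n, m, rfl⟩ := exists_eq x
    rw [TensorProduct.tmul_add, map_add, map_add]
    exact congrArg₂ (· + ·) (LinearMap.congr_fun hl (a ⊗ₜ n)) (LinearMap.congr_fun hr (a ⊗ₜ m))

/-- The coaction of a twisted sum. -/
def coact : TwistedSum z →ₗ[k] TwistedSum z ⊗[k] A :=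
  coprod z ((inl z).rTensor A ∘ₗ rho k A N)
    ((inl z).rTensor A ∘ₗ z.1.2 + (inr z).rTensor A ∘ₗ rho k A M)

theorem coact_comp_inl : coact z ∘ₗ inl z = (inl z).rTensor A ∘ₗ rho k A N :=
  coprod_comp_inl z _ _

theorem coact_comp_inr : coact z ∘ₗ inr z =
    (inl z).rTensor A ∘ₗ z.1.2 + (inr z).rTensor A ∘ₗ rho k A M :=
  coprod_comp_inr z _ _

/-- The inclusion of `N`, as a map of `A`-modules. -/
def inlA : N →ₗ[A] TwistedSum z :=
  { inl z with map_smul' := fun a n => (smul_inl z a n).symm }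

/-- Each axiom is checked on `N` and on `M` separately. On `N` it is inherited, since `inl` respects
both structures. On `M`, the `inr`-part is the axiom for `M`, and the `inl`-part is the second
cocycle equation, the vanishing of `(id ⊗ ε) ∘ ρ'`, or the third cocycle equation, respectively. -/
instance : HopfModule k A (TwistedSum z) where
  coact := coact z
  coact_coassoc := by
    refine hom_ext ?_ ?_
    · rw [← assoc_rTensor_nat _ _ _ (coact_comp_inl z).symm,
        ← lTensor_comul_nat _ _ _ (coact_comp_inl z).symm, RightComodule.coact_coassoc]
    · rw [assoc_rTensor_skew (coact_comp_inl z) (coact_comp_inr z),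
        lTensor_comul_skew (coact_comp_inr z), RightComodule.coact_coassoc, z.2.2.1]
  coact_counit := by
    refine hom_ext ?_ ?_
    · rw [← counit_nat _ _ _ (coact_comp_inl z).symm, RightComodule.coact_counit,
        LinearMap.comp_id, LinearMap.id_comp]
    · rw [counit_skew (coact_comp_inr z), RightComodule.coact_counit, Z1.counit_comp_eq_zero,
        LinearMap.comp_zero, zero_add, LinearMap.comp_id, LinearMap.id_comp]
  compat := by
    refine tensor_hom_ext z ?_ ?_
    · have h := twist_omega_nat (inlA z) (rho k A N) (coact z) (coact_comp_inl z).symm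
      refine Eq.trans ?_ h
      rw [← HopfModule.compat, LinearMap.comp_assoc, omega_comp_inl, ← LinearMap.comp_assoc,
        coact_comp_inl]
      rfl
    · rw [comp_action_skew (coact_comp_inl z) (coact_comp_inr z) (omega_comp_inr z),
        twist_skew (coact_comp_inr z) (omega_comp_inl z) (omega_comp_inr z), z.2.2.2,
        HopfModule.compat]

/-- The extension of `M` by `N` given by a cocycle. -/
def extension : Extension k A M N where
  E := TwistedSum z
  i := inlA z
  p :=
    { coprod z 0 LinearMap.id with
      map_smul' := fun a x => by
        obtain ⟨n, m, rfl⟩ := exists_eq x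
        simp }
  colinear_i := coact_comp_inl z
  colinear_p := by
    refine hom_ext ?_ ?_
    · change rho k A M ∘ₗ coprod z 0 LinearMap.id ∘ₗ inl z =
        (coprod z 0 LinearMap.id).rTensor A ∘ₗ coact z ∘ₗ inl z
      rw [coact_comp_inl, ← LinearMap.comp_assoc (rho k A N), ← LinearMap.rTensor_comp, coprod_comp_inl,
        LinearMap.comp_zero, LinearMap.rTensor_zero, LinearMap.zero_comp]
    · change rho k A M ∘ₗ coprod z 0 LinearMap.id ∘ₗ inr z =
        (coprod z 0 LinearMap.id).rTensor A ∘ₗ coact z ∘ₗ inr z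
      rw [coact_comp_inr, LinearMap.comp_add, ← LinearMap.comp_assoc z.1.2,
        ← LinearMap.rTensor_comp, ← LinearMap.comp_assoc (rho k A M), ← LinearMap.rTensor_comp, coprod_comp_inl, coprod_comp_inr,
        LinearMap.rTensor_zero, LinearMap.zero_comp, zero_add, LinearMap.rTensor_id,
        LinearMap.comp_id, LinearMap.id_comp]
  injective := LinearMap.inl_injective (R := k) (M := N) (M₂ := M)
  exact x := by
    change (coprod z 0 LinearMap.id) x = 0 ↔ x ∈ Set.range (inl z)
    obtain ⟨n, m, rfl⟩ := exists_eq x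
    constructor
    · intro h
      simp only [map_add, coprod_inl_apply, coprod_inr_apply, LinearMap.zero_apply,
        LinearMap.id_apply, zero_add] at h
      exact ⟨n, by rw [h, map_zero, add_zero]⟩
    · rintro ⟨n', h⟩
      rw [← h, coprod_inl_apply, LinearMap.zero_apply]
  surjective m := ⟨inr z m, coprod_inr_apply z _ _ m⟩

end TwistedSum

end twistedSum

/-- It turns exactness into actual maps: the components `ω'` and `ρ'` of a cocycle, and the `f` of a
coboundary, all arise as such factorizations. -/
theorem exists_comp_eq_of_forall_mem_range {k L N E : Type*} [Field k] [AddCommGroup L] [Module k L]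
    [AddCommGroup N] [Module k N] [AddCommGroup E] [Module k E] {i : N →ₗ[k] E}
    (hi : Function.Injective i) (g : L →ₗ[k] E) (hg : ∀ l, g l ∈ LinearMap.range i) :
    ∃ h : L →ₗ[k] N, i ∘ₗ h = g :=
  ⟨(LinearEquiv.ofInjective i hi).symm.toLinearMap ∘ₗ g.codRestrict _ hg, LinearMap.ext fun l =>
    congrArg Subtype.val ((LinearEquiv.ofInjective i hi).apply_symm_apply ⟨g l, hg l⟩)⟩

/-! ### Sections of an extension and their cocycles -/

namespace Extension

variable {k : Type v} {A M N : Type u} [Field k] [Ring A] [Bialgebra k A]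
  [AddCommGroup M] [Module k M] [Module A M] [IsScalarTower k A M] [HopfModule k A M]
  [AddCommGroup N] [Module k N] [Module A N] [IsScalarTower k A N] [HopfModule k A N]

/-- The `k`-linear section `s` of the extension `X` has the pair `(ω', ρ')` as its cocycle: `ω'` and
`ρ'` measure the failure of `s` to be `A`-linear and to be colinear. -/
structure IsSection (X : Extension k A M N) (z : (A ⊗[k] M →ₗ[k] N) × (M →ₗ[k] N ⊗[k] A))
    (s : M →ₗ[k] X.E) : Prop where
  p_comp : X.p.restrictScalars k ∘ₗ s = LinearMap.id
  omega_comp : omega k A X.E ∘ₗ s.lTensor A =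
    X.i.restrictScalars k ∘ₗ z.1 + s ∘ₗ omega k A M
  rho_comp : rho k A X.E ∘ₗ s =
    (X.i.restrictScalars k).rTensor A ∘ₗ z.2 + s.rTensor A ∘ₗ rho k A M

variable {X Y : Extension k A M N} {z w : (A ⊗[k] M →ₗ[k] N) × (M →ₗ[k] N ⊗[k] A)}
  {s : M →ₗ[k] X.E} {t : M →ₗ[k] Y.E}

/-- Vector spaces are flat, so identities in `N ⊗ V` may be checked in `E ⊗ V`. -/
theorem rTensor_i_injective (X : Extension k A M N) (V : Type*) [AddCommGroup V] [Module k V] :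
    Function.Injective ((X.i.restrictScalars k).rTensor V) :=
  Module.Flat.rTensor_preserves_injective_linearMap _ X.injective

theorem p_comp_i (X : Extension k A M N) :
    X.p.restrictScalars k ∘ₗ X.i.restrictScalars k = 0 :=
  LinearMap.ext fun n => (X.exact _).2 ⟨n, rfl⟩

theorem IsSection.smul_apply (h : X.IsSection z s) (a : A) (m : M) :
    a • s m = X.i (z.1 (a ⊗ₜ m)) + s (a • m) := by
  simpa using LinearMap.congr_fun h.omega_comp (a ⊗ₜ m)

theorem IsSection.p_apply (h : X.IsSection z s) (m : M) : X.p (s m) = m :=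
  LinearMap.congr_fun h.p_comp m

/-- The pair of a section is a cocycle. -/
theorem IsSection.mem_Z1 (h : X.IsSection z s) : z ∈ Z1 k A M N := by
  refine ⟨?_, ?_, ?_⟩
  · refine TensorProduct.ext' fun a y => ?_
    induction y with
    | zero => simp only [TensorProduct.tmul_zero, map_zero]
    | add y y' hy hy' => simp only [TensorProduct.tmul_add, map_add, hy, hy']
    | tmul b m =>
      apply X.injective
      -- The element `(a * b) • s m` is computed directly and as `a • (b • s m)`; the `s`-parts
      -- agree and cancel.
      have e := h.smul_apply (a * b) m
      rw [mul_smul, h.smul_apply, smul_add, h.smul_apply, mul_smul, ← map_smul, ← add_assoc,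
        add_left_inj, ← map_add] at e
      simpa [add_comm] using e
  · refine (LinearMap.cancel_left (X.rTensor_i_injective (A ⊗[k] A))).1 ?_
    -- Coassociativity of `E` is expanded along `s` on both sides; the `s`-parts agree by
    -- coassociativity of `M`.
    have e := assoc_rTensor_skew X.colinear_i h.rho_comp
    rw [RightComodule.coact_coassoc, RightComodule.coact_coassoc, lTensor_comul_skew h.rho_comp,
      add_left_inj] at e
    exact e.symm
  · refine (LinearMap.cancel_left (X.rTensor_i_injective A)).1 ?_
    -- The same with compatibility: that of `E` equates the two expansions, and that of `M` cancels
    -- their `s`-parts.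
    have e := twist_skew h.rho_comp (omega_nat X.i).symm h.omega_comp
    rw [← HopfModule.compat, ← HopfModule.compat,
      comp_action_skew X.colinear_i h.rho_comp h.omega_comp, add_left_inj] at e
    exact e.symm

/-- Every extension has a `k`-linear section. -/
theorem exists_isSection (X : Extension k A M N) : ∃ z s, X.IsSection z s := by
  obtain ⟨s, hs⟩ := (X.p.restrictScalars k).exists_rightInverse_of_surjective
    (LinearMap.range_eq_top.2 X.surjective)
  have hps : ∀ m, X.p (s m) = m := LinearMap.congr_fun hs
  obtain ⟨ω', hω⟩ := exists_comp_eq_of_forall_mem_range (i := X.i.restrictScalars k) X.injective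
    (omega k A X.E ∘ₗ s.lTensor A - s ∘ₗ omega k A M) fun l => by
      -- The defect lies in the kernel of `p`, because `p` is `A`-linear and `p ∘ s = id`.
      refine (X.exact _).1 ?_
      induction l with
      | zero => simp only [map_zero]
      | add y y' hy hy' => simp only [map_add, hy, hy', add_zero]
      | tmul a m => simp [hps]
  obtain ⟨ρ', hρ⟩ := exists_comp_eq_of_forall_mem_range (X.rTensor_i_injective A)
    (rho k A X.E ∘ₗ s - s.rTensor A ∘ₗ rho k A M) fun m => by
      -- Exactness survives tensoring with `A` over a field, and `p ⊗ id` kills the defect because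
      -- `p` is colinear.
      have hex : Function.Exact (X.i.restrictScalars k) (X.p.restrictScalars k) := X.exact
      refine (Module.Flat.rTensor_exact A hex _).1 ?_
      have e := LinearMap.congr_fun X.colinear_p (s m)
      simp only [LinearMap.comp_apply, LinearMap.coe_restrictScalars, hps] at e
      rw [LinearMap.sub_apply, map_sub, LinearMap.comp_apply, LinearMap.comp_apply, ← e,
        ← LinearMap.rTensor_comp_apply, hs, LinearMap.rTensor_id, LinearMap.id_apply, sub_self]
  exact ⟨(ω', ρ'), s, hs, sub_eq_iff_eq_add.1 hω.symm, sub_eq_iff_eq_add.1 hρ.symm⟩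

/-- Changing a section changes its cocycle by a coboundary. -/
theorem IsSection.sub_mem_B1 {s' : M →ₗ[k] X.E} (h : X.IsSection z s) (h' : X.IsSection w s') :
    z - w ∈ B1 k A M N := by
  -- Both sections split `p`, so `s - s'` takes values in the image of `N`.
  obtain ⟨f, hf⟩ := exists_comp_eq_of_forall_mem_range (i := X.i.restrictScalars k) X.injective
    (s - s') fun m => (X.exact _).1 (by simp [h.p_apply, h'.p_apply])
  have hs : s = X.i.restrictScalars k ∘ₗ f + s' := sub_eq_iff_eq_add.1 hf.symm
  refine ⟨f, Prod.ext ?_ ?_⟩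
  · refine (LinearMap.cancel_left (f := X.i.restrictScalars k) X.injective).1 ?_
    have e := h.omega_comp
    rw [hs, LinearMap.lTensor_add, LinearMap.comp_add, LinearMap.lTensor_comp,
      ← LinearMap.comp_assoc, ← omega_nat, h'.omega_comp, LinearMap.add_comp] at e
    simp only [LinearMap.comp_assoc] at e
    rw [Prod.fst_sub, LinearMap.comp_sub, LinearMap.comp_sub, sub_eq_sub_iff_add_eq_add]
    rw [← add_assoc, ← add_assoc, add_left_inj] at e
    exact e.symm
  · refine (LinearMap.cancel_left (X.rTensor_i_injective A)).1 ?_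
    have e := h.rho_comp
    have hi : rho k A X.E ∘ₗ X.i.restrictScalars k = _ := X.colinear_i
    rw [hs, LinearMap.rTensor_add, LinearMap.comp_add, LinearMap.rTensor_comp,
      ← LinearMap.comp_assoc, hi, h'.rho_comp, LinearMap.add_comp] at e
    simp only [LinearMap.comp_assoc] at e
    rw [Prod.snd_sub, LinearMap.comp_sub, LinearMap.comp_sub, sub_eq_sub_iff_add_eq_add]
    rw [← add_assoc, ← add_assoc, add_left_inj] at e
    exact e.symm

/-- Cohomologous cocycles belong to sections of the same extension. -/
theorem IsSection.of_sub_mem_B1 (h : X.IsSection w s) (hzw : z - w ∈ B1 k A M N) :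
    ∃ s', X.IsSection z s' := by
  obtain ⟨f, hf⟩ := hzw
  have hz := sub_eq_iff_eq_add.1 hf
  -- Shifting the section by `i ∘ f` adds the coboundary of `f` to its cocycle.
  refine ⟨X.i.restrictScalars k ∘ₗ f + s, ?_, ?_, ?_⟩
  · rw [LinearMap.comp_add, ← LinearMap.comp_assoc, p_comp_i, LinearMap.zero_comp, zero_add,
      h.p_comp]
  · rw [hz, LinearMap.lTensor_add, LinearMap.comp_add, LinearMap.lTensor_comp,
      ← LinearMap.comp_assoc, ← omega_nat, h.omega_comp]
    simp only [Prod.fst_add, LinearMap.comp_add, LinearMap.add_comp, LinearMap.comp_sub,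
      LinearMap.comp_assoc]
    abel
  · have hi : rho k A X.E ∘ₗ X.i.restrictScalars k = _ := X.colinear_i
    rw [hz, LinearMap.rTensor_add, LinearMap.comp_add, LinearMap.rTensor_comp,
      ← LinearMap.comp_assoc, hi, h.rho_comp]
    simp only [Prod.snd_add, LinearMap.comp_add, LinearMap.add_comp, LinearMap.comp_sub,
      LinearMap.comp_assoc]
    abel

/-- The section is carried along the equivalence. Its defects are carried with it, since the
equivalence is linear and colinear, and they keep the same components because it is the identity on
`N`. -/
theorem IsSection.of_equivalent (h : X.IsSection z s) (hXY : X.Equivalent Y) :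
    ∃ t, Y.IsSection z t := by
  obtain ⟨φ, hφ, hi, hp⟩ := hXY
  set ψ : X.E →ₗ[k] Y.E := (φ : X.E →ₗ[A] Y.E).restrictScalars k with hψ
  have hi' : ψ ∘ₗ X.i.restrictScalars k = Y.i.restrictScalars k :=
    LinearMap.ext fun n => LinearMap.congr_fun hi n
  have hp' : Y.p.restrictScalars k ∘ₗ ψ = X.p.restrictScalars k :=
    LinearMap.ext fun n => LinearMap.congr_fun hp n
  have hρ : rho k A Y.E ∘ₗ ψ = ψ.rTensor A ∘ₗ rho k A X.E := hφ
  refine ⟨ψ ∘ₗ s, ?_, ?_, ?_⟩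
  · rw [← LinearMap.comp_assoc, hp', h.p_comp]
  · rw [LinearMap.lTensor_comp, ← LinearMap.comp_assoc, ← omega_nat, LinearMap.comp_assoc,
      h.omega_comp, LinearMap.comp_add, ← hi']
    rfl
  · rw [← LinearMap.comp_assoc, hρ, LinearMap.comp_assoc, h.rho_comp, LinearMap.comp_add, ← hi',
      LinearMap.rTensor_comp, LinearMap.rTensor_comp]
    rfl

theorem isSection_twistedSum (z : Z1 k A M N) :
    (TwistedSum.extension z).IsSection z.1 (TwistedSum.inr z) where
  p_comp := TwistedSum.coprod_comp_inr z _ _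
  omega_comp := TwistedSum.omega_comp_inr z
  rho_comp := TwistedSum.coact_comp_inr z

/-- An extension is equivalent to the twisted sum of the cocycle of a section. -/
theorem IsSection.equivalent (z : Z1 k A M N) (h : X.IsSection z.1 s) :
    (TwistedSum.extension z).Equivalent X := by
  -- The splitting `N ⊕ M ≅ E` given by `i` and `s` respects the twisted structures by the very
  -- definition of the cocycle of `s`; bijectivity is then automatic for a morphism of extensions.
  let ψ : TwistedSum z →ₗ[k] X.E := TwistedSum.coprod z (X.i.restrictScalars k) s
  let φ : TwistedSum z →ₗ[A] X.E :=
    { ψ with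
      map_smul' := fun a x => by
        obtain ⟨n, m, rfl⟩ := TwistedSum.exists_eq x
        simp [ψ, h.smul_apply] }
  have hφ : rho k A X.E ∘ₗ ψ = ψ.rTensor A ∘ₗ TwistedSum.coact z := by
    refine TwistedSum.hom_ext ?_ ?_
    · rw [LinearMap.comp_assoc, LinearMap.comp_assoc, TwistedSum.coact_comp_inl,
        ← LinearMap.comp_assoc (rho k A N), ← LinearMap.rTensor_comp, TwistedSum.coprod_comp_inl]
      exact X.colinear_i
    · rw [LinearMap.comp_assoc, LinearMap.comp_assoc, TwistedSum.coact_comp_inr,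
        LinearMap.comp_add, ← LinearMap.comp_assoc z.1.2, ← LinearMap.comp_assoc (rho k A M),
        ← LinearMap.rTensor_comp, ← LinearMap.rTensor_comp, TwistedSum.coprod_comp_inl,
        TwistedSum.coprod_comp_inr, h.rho_comp]
  refine .of_hom (X := TwistedSum.extension z) φ hφ (fun n => ?_) (fun x => ?_)
  · exact TwistedSum.coprod_inl_apply z _ _ n
  · obtain ⟨n, m, rfl⟩ := TwistedSum.exists_eq (z := z) x
    have hn : X.p (X.i n) = 0 := (X.exact _).2 ⟨n, rfl⟩
    change X.p (ψ _) = TwistedSum.coprod z 0 LinearMap.id _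
    simp [ψ, h.p_apply, hn]

/-- The map `N → E ×_M E'`, `n ↦ (0, n)`. -/
def inrN (X Y : Extension k A M N) : N →ₗ[A] X.Pullback Y :=
  (LinearMap.prod 0 Y.i).codRestrict _ fun n => by
    simp [diff, (Y.exact _).2 ⟨n, rfl⟩]

/-- The elements `(n, 0)` and `(0, n)` differ by `(n, -n)`, which the Baer sum kills. -/
theorem mkQ_comp_inrN (X Y : Extension k A M N) :
    (LinearMap.range (X.anti Y)).mkQ ∘ₗ X.inrN Y = (X.baer Y).i :=
  LinearMap.ext fun n => ((Submodule.Quotient.eq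
    (LinearMap.range (X.anti Y)) (x := X.inlN Y n) (y := X.inrN Y n)).2 ⟨n, Subtype.ext (Prod.ext
    ((sub_zero (X.i n)).symm) (zero_sub (Y.i n)).symm)⟩).symm

/-- The cocycles of sections add up in the Baer sum. -/
theorem IsSection.baer (h : X.IsSection z s) (h' : Y.IsSection w t) :
    ∃ r, (X.baer Y).IsSection (z + w) r := by
  let ι := kerIncl k (X.diff Y)
  let π := (LinearMap.range (X.anti Y)).mkQ.restrictScalars k
  let iX := (X.inlN Y).restrictScalars k
  let iY := (X.inrN Y).restrictScalars k
  -- The pair `(s, t)` lands in the fibre product, since both components lie over the same `m`. Its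
  -- defects are those of `s` and `t`, placed in the two copies of `N`.
  let σ : M →ₗ[k] X.Pullback Y :=
    LinearMap.codRestrict ((LinearMap.ker (X.diff Y)).restrictScalars k) (s.prod t) fun m => by
      simp [diff, h.p_apply, h'.p_apply]
  have hω : omega k A (X.Pullback Y) ∘ₗ σ.lTensor A =
      iX ∘ₗ z.1 + iY ∘ₗ w.1 + σ ∘ₗ omega k A M := by
    refine TensorProduct.ext' fun a m => ?_
    rw [LinearMap.comp_apply, LinearMap.lTensor_tmul, omega_tmul, LinearMap.add_apply,
      LinearMap.comp_apply σ, omega_tmul]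
    refine Subtype.ext (Prod.ext ?_ ?_)
    · exact (h.smul_apply a m).trans (congrArg (· + s (a • m)) (add_zero _).symm)
    · exact (h'.smul_apply a m).trans (congrArg (· + t (a • m)) (zero_add _).symm)
  have hρ : rho k A (X.Pullback Y) ∘ₗ σ =
      iX.rTensor A ∘ₗ z.2 + iY.rTensor A ∘ₗ w.2 + σ.rTensor A ∘ₗ rho k A M := by
    -- The coaction of the fibre product is known only through its inclusion into `E × E'`, which
    -- stays injective after tensoring with `A`.
    refine (LinearMap.cancel_left (kerIncl_rTensor_injective (k := k) (X.diff Y))).1 ?_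
    have e1 : ι ∘ₗ iX = LinearMap.inl k X.E Y.E ∘ₗ X.i.restrictScalars k := rfl
    have e2 : ι ∘ₗ iY = LinearMap.inr k X.E Y.E ∘ₗ Y.i.restrictScalars k := rfl
    have e3 : ι ∘ₗ σ = LinearMap.inl k X.E Y.E ∘ₗ s + LinearMap.inr k X.E Y.E ∘ₗ t :=
      LinearMap.ext fun m => Prod.ext (add_zero (s m)).symm (zero_add (t m)).symm
    have e4 : ι.rTensor A ∘ₗ rho k A (X.Pullback Y) = prodCoact k A X.E Y.E ∘ₗ ι :=
      LinearMap.ext (X.rho_pullback Y)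
    change ι.rTensor A ∘ₗ _ = ι.rTensor A ∘ₗ _
    rw [← LinearMap.comp_assoc, e4, LinearMap.comp_assoc, e3, LinearMap.comp_add,
      ← LinearMap.comp_assoc, ← LinearMap.comp_assoc, prodCoact, LinearMap.coprod_inl,
      LinearMap.coprod_inr, LinearMap.comp_assoc, LinearMap.comp_assoc, h.rho_comp, h'.rho_comp]
    simp only [LinearMap.comp_add, ← LinearMap.comp_assoc, ← LinearMap.rTensor_comp, e1, e2, e3,
      LinearMap.rTensor_add, LinearMap.add_comp]
    abel
  -- In the quotient the two copies of `N` become one, and so the two cocycles add.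
  have hX : π ∘ₗ iX = (X.baer Y).i.restrictScalars k := rfl
  have hY : π ∘ₗ iY = (X.baer Y).i.restrictScalars k :=
    congrArg (LinearMap.restrictScalars k) (X.mkQ_comp_inrN Y)
  refine ⟨π ∘ₗ σ, LinearMap.ext h.p_apply, ?_, ?_⟩
  · have e : omega k A (X.BaerE Y) ∘ₗ (π ∘ₗ σ).lTensor A = π ∘ₗ (iX ∘ₗ z.1 + iY ∘ₗ w.1 +
        σ ∘ₗ omega k A M) := by
      rw [LinearMap.lTensor_comp, ← LinearMap.comp_assoc, ← omega_nat, LinearMap.comp_assoc, hω]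
    refine e.trans ?_
    rw [LinearMap.comp_add, LinearMap.comp_add, ← LinearMap.comp_assoc, ← LinearMap.comp_assoc,
      hX, hY, Prod.fst_add, LinearMap.comp_add]
    rfl
  · have e : rho k A (X.BaerE Y) ∘ₗ π ∘ₗ σ = π.rTensor A ∘ₗ (iX.rTensor A ∘ₗ z.2 +
        iY.rTensor A ∘ₗ w.2 + σ.rTensor A ∘ₗ rho k A M) := by
      rw [← hρ]; rfl
    refine e.trans ?_
    rw [LinearMap.comp_add, LinearMap.comp_add, ← LinearMap.comp_assoc, ← LinearMap.comp_assoc,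
      ← LinearMap.comp_assoc, ← LinearMap.rTensor_comp, ← LinearMap.rTensor_comp,
      ← LinearMap.rTensor_comp, hX, hY, Prod.snd_add, LinearMap.comp_add]
    rfl

/-- An equivalence moves the section `inr` of the first extension to a section of the second with
the same cocycle, where it is compared with the second `inr`. Conversely, a section of the second
extension with cocycle `z` identifies it with the twisted sum of `z`. -/
theorem twistedSum_equivalent_iff (z w : Z1 k A M N) :
    (TwistedSum.extension z).Equivalent (TwistedSum.extension w) ↔
      z.1 - w.1 ∈ B1 k A M N := by
  constructor
  · intro h
    obtain ⟨t, ht⟩ := (isSection_twistedSum z).of_equivalent h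
    exact ht.sub_mem_B1 (isSection_twistedSum w)
  · intro h
    obtain ⟨t, ht⟩ := (isSection_twistedSum w).of_sub_mem_B1 h
    exact ht.equivalent z

end Extension

/-! ### Comparison of cohomology with extension classes -/

section ext

variable (k : Type v) (A M N : Type u) [Field k] [Ring A] [Bialgebra k A]
  [AddCommGroup M] [Module k M] [Module A M] [IsScalarTower k A M] [HopfModule k A M]
  [AddCommGroup N] [Module k N] [Module A N] [IsScalarTower k A N] [HopfModule k A N]

/-- No computation is needed: a coboundary is the cocycle of a shifted section of the split
extension, and cocycles of sections satisfy the equations of `Z1`. -/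
theorem B1_le_Z1 : B1 k A M N ≤ Z1 k A M N := by
  intro w hw
  have h := (Extension.isSection_twistedSum (0 : Z1 k A M N)).of_sub_mem_B1 (z := w)
    (by simpa using hw)
  exact h.choose_spec.mem_Z1

/-- The map from `Z¹(M, N) / B¹(M, N)` to the classes of extensions. -/
def extClass : Z1 k A M N ⧸ (B1 k A M N).submoduleOf (Z1 k A M N) → Ext1 k A M N :=
  Quotient.map' TwistedSum.extension fun z w h =>
    (Extension.twistedSum_equivalent_iff z w).2
      ((Submodule.quotientRel_def ((B1 k A M N).submoduleOf (Z1 k A M N))).1 h)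

/-- Injectivity holds because equivalent twisted sums have cohomologous cocycles; surjectivity
because every extension has a `k`-linear section, and is the twisted sum of its cocycle. -/
theorem extClass_bijective : Function.Bijective (extClass k A M N) := by
  constructor
  · rintro ⟨z⟩ ⟨w⟩ h
    exact (Submodule.Quotient.eq _).2
      ((Extension.twistedSum_equivalent_iff z w).1 (Quotient.exact h))
  · rintro ⟨X⟩
    obtain ⟨z, s, h⟩ := X.exists_isSection
    exact ⟨Submodule.Quotient.mk ⟨z, h.mem_Z1⟩, Quotient.sound (h.equivalent ⟨z, h.mem_Z1⟩)⟩

/-- `Z¹(M, N) / B¹(M, N)` is isomorphic to `Ext¹(M, N)` with the Baer sum. -/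
def extEquiv : (Z1 k A M N ⧸ (B1 k A M N).submoduleOf (Z1 k A M N)) ≃+ Ext1 k A M N :=
  { Equiv.ofBijective _ (extClass_bijective k A M N) with
    map_add' := by
      rintro ⟨z⟩ ⟨w⟩
      -- The Baer sum of the two twisted sums has a section with cocycle `z + w`, so it is
      -- equivalent to the twisted sum of `z + w`.
      obtain ⟨r, hr⟩ := (Extension.isSection_twistedSum z).baer (Extension.isSection_twistedSum w)
      exact Quotient.sound (hr.equivalent (z + w)) }

end ext

end

end HopfCoh

/-- For left-right Hopf modules `M`, `N` over a bialgebra `A` over a field `k`: the first cohomology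
of the total complex of `C^{n,p}(M, N)` is `Z¹(M, N) / B¹(M, N)`, a cocycle being identified with the
pair of its components in `Hom (A ⊗ M, N)` and `Hom (M, N ⊗ A)`, and it is isomorphic, as a group, to
the group `Ext¹(M, N)` of extensions of `M` by `N` under the Baer sum. -/
theorem mainTheorem5 {k : Type v} {A M N : Type u} [Field k] [Ring A] [Bialgebra k A]
    [AddCommGroup M] [Module k M] [Module A M] [IsScalarTower k A M] [HopfCoh.HopfModule k A M]
    [AddCommGroup N] [Module k N] [Module A N] [IsScalarTower k A N] [HopfCoh.HopfModule k A N] :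
    HopfCoh.B1 k A M N ≤ HopfCoh.Z1 k A M N ∧
    (∃ Θ : HopfCoh.H k A M N 1 ≃ₗ[k]
        HopfCoh.Z1 k A M N ⧸ (HopfCoh.B1 k A M N).submoduleOf (HopfCoh.Z1 k A M N),
      ∀ z : LinearMap.ker (HopfCoh.totD k A M N 1),
        ∃ w : HopfCoh.Z1 k A M N,
          w.1.1 = z.1 ⟨(1, 0), rfl⟩ ∧ w.1.2 = z.1 ⟨(0, 1), rfl⟩ ∧
          Θ (Submodule.Quotient.mk z) = Submodule.Quotient.mk w) ∧
    Nonempty (HopfCoh.H k A M N 1 ≃+ HopfCoh.Ext1 k A M N) :=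
  ⟨HopfCoh.B1_le_Z1 k A M N,
    ⟨HopfCoh.hOneEquiv k A M N, fun z => ⟨HopfCoh.kerTotDOneEquiv k A M N z, rfl, rfl, rfl⟩⟩,
    ⟨(HopfCoh.hOneEquiv k A M N).toAddEquiv.trans (HopfCoh.extEquiv k A M N)⟩⟩
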